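/- Let $k$ be a unital commutative ring and let $A$ be an associative unital $k$-algebra with an involution $a\mapsto\overline a$ (a $k$-linear anti-homomorphism of algebras whose square is the identity) and an augmentation $\varepsilon\colon A\to k$ (a homomorphism of $k$-algebras) that is compatible with the involution, that is $\varepsilon(\overline a)=\varepsilon(a)$ for all $a$. Let $I=\ker\varepsilon$. *The categories.* Let $C_2=\langle t\mid t^2=1\rangle$ and let $\Delta H$ be the hyperoctahedral category. Its objects are the sets $[n]=\{0,\dots,n\}$, $n\geq 0$, and a morphism $[n]\to[m]$ is a pair $(\phi,g)$ of an order-preserving map $\phi\colon[n]\to[m]$ and an element $g=(z_0,\dots,z_n;\sigma)$ of the hyperoctahedral group $H_{n+1}=C_2^{n+1}\rtimes\Sigma_{n+1}$. Here $(z;\sigma)$ is regarded as the permutation $i\mapsto\sigma(i)$ in which $i$ carries the label $z_i$, so that $(w;\tau)(z;\sigma)=((w_{\sigma(i)}z_i)_i;\tau\sigma)$. Composition is $(\psi,h)\circ(\phi,g)=(\psi\circ h_\star(\phi),\ \phi^\star(h)\, g)$, where for $\phi\colon[n]\to[m]$ and $h=(w;\tau)\in H_{m+1}$ the element $\phi^\star(h)=(w\circ\phi;\rho)\in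 H_{n+1}$ and the order-preserving map $h_\star(\phi)$ are the unique ones such that $h_\star(\phi)\circ\rho=\tau\circ\phi$ and such that $\rho$ is increasing on $\phi^{-1}(j)$ if $w_j=1$ and decreasing on $\phi^{-1}(j)$ if $w_j=t$. Let $\mathrm{Epi}\Delta H$ be the subcategory of $\Delta H$ with all objects, whose morphisms are the epimorphisms of $\Delta H$ (equivalently, the $(\phi,g)$ with $\phi$ surjective). *The functors.* Let $\mathsf H_A\colon\Delta H\to\mathbf{Mod}_k$ be the functor with $\mathsf H_A([n])=A^{\otimes n+1}$ that sends $(\phi,(z;\sigma))\colon[n]\to[m]$ to the map $a_0\otimes\cdots\otimes a_n\mapsto b_0\otimes\cdots\otimes b_m$. Here $b_j$ is the product of the $a_i^{z_i}$ over all $i$ with $\phi(\sigma(i))=j$, in increasing order of $\sigma(i)$, where $a^1=a$, $a^t=\overline a$, and the empty product is $1$. Let $\mathsf H_I\colon\mathrm{Epi}\Delta H\to\mathbf{Mod}_k$ be the functor with $\mathsf H_I([n])=I^{\otimes n+1}$ that is given on morphisms by the same formula. *The complexes.* For a small category $\mathbf C$ and a functor $F\colon\mathbf C\to\mathbf{Mod}_k$,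 let $k[N_\star(-\downarrow\mathbf C)]\otimes_{\mathbf C}F$ be the chain complex of the simplicial $k$-module that is in degree $n$ the tensor product over $\mathbf C$ of $F$ with the contravariant functor sending $C$ to the free $k$-module on $N_n(C\downarrow\mathbf C)$. Here $C\downarrow\mathbf C$ is the under-category, $N_\star$ is the nerve, and $G\otimes_{\mathbf C}F$ is the quotient of $\bigoplus_C G(C)\otimes_kF(C)$ by the relations $G(\alpha)(x)\otimes y=x\otimes F(\alpha)(y)$. This module is spanned by classes $[(f_n,\dots,f_1,f_0)\otimes x]$ with $f_0\colon C\to C_0$, $f_i\colon C_{i-1}\to C_i$ and $x\in F(C)$. Let $C_\star(\mathbf C,F)$ be the chain complex of the simplicial $k$-module $C_n(\mathbf C,F)=\bigoplus_{C_0\xrightarrow{f_1}\cdots\xrightarrow{f_n}C_n}F(C_0)$ whose face map $\partial_0$ is $(f_n,\dots,f_1,x)\mapsto(f_n,\dots,f_2,F(f_1)(x))$ and whose other faces compose adjacent arrows or drop $f_n$. In both cases the boundary map is the alternating sum of the face maps. *Reduced hyperoctahedral homology.* Let $C_\star(\Delta H,I)$ be the subcomplex of $k[N_\star(-\downarrow\Delta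 H)]\otimes_{\Delta H}\mathsf H_A$ that is generated in degree $n$ by the classes $[(f_n,\dots,f_0)\otimes(a_0\otimes\cdots\otimes a_x)]$ with all $a_i\in I$. The reduced hyperoctahedral homology of $A$ is $\widetilde{HO}_n(A)=H_n(C_\star(\Delta H,I))$. **Theorem.** The inclusion of chain complexes $$i_\star\colon k[N_\star(-\downarrow\mathrm{Epi}\Delta H)]\otimes_{\mathrm{Epi}\Delta H}\mathsf H_I\longrightarrow C_\star(\Delta H,I),\qquad [(f_n,\dots,f_0)\otimes Y]\mapsto[(f_n,\dots,f_0)\otimes Y],$$ is a chain homotopy equivalence, and for every $n\geq0$ there are isomorphisms of $k$-modules $$\widetilde{HO}_n(A)\;\cong\;H_n\bigl(k[N_\star(-\downarrow\mathrm{Epi}\Delta H)]\otimes_{\mathrm{Epi}\Delta H}\mathsf H_I\bigr)\;\cong\;H_n\bigl(C_\star(\mathrm{Epi}\Delta H,\mathsf H_I)\bigr).$$ -/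

import Mathlib

open CategoryTheory Opposite TensorProduct DirectSum

noncomputable section

namespace Hyperoctahedral

/-! ### The hyperoctahedral groups -/

/-- The cyclic group `⟨t | t² = 1⟩` of order two, with `t = -1`. -/
abbrev C2 : Type := ℤˣ

/-- The hyperoctahedral group of degree `m`: the semi-direct product of `C2 ^ m` with the symmetric
group on `Fin m`.  The element `(z; σ)` sends `i` to `σ i` and carries the label `z i` at the point
`i` of the source, so that `(w; τ) * (z; σ) = (i ↦ w (σ i) * z i; τ ∘ σ)`. -/
@[ext]
structure HypGroup (m : ℕ) : Type where
  label : Fin m → C2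
  perm : Equiv.Perm (Fin m)

namespace HypGroup

variable {m : ℕ}

instance : Mul (HypGroup m) := ⟨fun h g => ⟨fun i => h.label (g.perm i) * g.label i, h.perm * g.perm⟩⟩
instance : One (HypGroup m) := ⟨⟨fun _ => 1, 1⟩⟩
instance : Inv (HypGroup m) := ⟨fun g => ⟨fun i => (g.label (g.perm⁻¹ i))⁻¹, g.perm⁻¹⟩⟩

@[simp] lemma mul_label (h g : HypGroup m) (i : Fin m) :
    (h * g).label i = h.label (g.perm i) * g.label i := rfl
@[simp] lemma mul_perm (h g : HypGroup m) : (h * g).perm = h.perm * g.perm := rfl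
@[simp] lemma one_label (i : Fin m) : (1 : HypGroup m).label i = 1 := rfl
@[simp] lemma one_perm : (1 : HypGroup m).perm = 1 := rfl
@[simp] lemma inv_label (g : HypGroup m) (i : Fin m) :
    g⁻¹.label i = (g.label (g.perm⁻¹ i))⁻¹ := rfl
@[simp] lemma inv_perm (g : HypGroup m) : g⁻¹.perm = g.perm⁻¹ := rfl

instance : Group (HypGroup m) :=
  Group.ofLeftAxioms
    (fun a b c => by ext <;> simp [mul_assoc])
    (fun a => by ext <;> simp)
    (fun a => by ext <;> simp)

end HypGroup

/-! ### The crossed simplicial structure -/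

section Crossed

variable {m n : ℕ}

/-- For `φ` order-preserving and `h = (w; τ)`, the point `p` of the source of `φ` goes to `τ (φ p)`,
and the fibre of `φ` through `p` is kept in its order if the label `w (φ p)` is `1` and is reversed
if it is `t`.  Sorting by this key puts the source into the resulting order. -/
def key (φ : Fin m →o Fin n) (h : HypGroup n) (p : Fin m) : Fin n ×ₗ Fin m :=
  toLex (h.perm (φ p), if h.label (φ p) = 1 then p else p.rev)

/-- The element `φ^* h` of the crossed simplicial group. -/
def pull (φ : Fin m →o Fin n) (h : HypGroup n) : HypGroup m where
  label p := h.label (φ p)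
  perm := (Tuple.sort (key φ h))⁻¹

/-- The order-preserving map `h_* φ` of the crossed simplicial group. -/
def push (h : HypGroup n) (φ : Fin m →o Fin n) : Fin m →o Fin n where
  toFun q := h.perm (φ (Tuple.sort (key φ h) q))
  monotone' q q' hq := by
    have := Tuple.monotone_sort (key φ h) hq
    exact Prod.Lex.monotone_fst _ _ this

/-- `p` precedes `q` when `e = 1`, and `q` precedes `p` when `e = t`. -/
def signedLT (e : C2) (p q : Fin m) : Prop := if e = 1 then p < q else q < p

lemma signedLT_one (p q : Fin m) : signedLT 1 p q ↔ p < q := by simp [signedLT]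

lemma signedLT_neg_one (p q : Fin m) : signedLT (-1) p q ↔ q < p := by
  simp [signedLT]

lemma key_injective (φ : Fin m →o Fin n) (h : HypGroup n) : Function.Injective (key φ h) := by
  intro p q hpq
  have h1 := congrArg (fun x => (ofLex x).1) hpq
  have h2 := congrArg (fun x => (ofLex x).2) hpq
  simp only [key, ofLex_toLex, EmbeddingLike.apply_eq_iff_eq] at h1 h2
  rw [h1] at h2
  split_ifs at h2 with hl
  · exact h2
  · exact Fin.rev_injective h2

lemma key_lt_iff (φ : Fin m →o Fin n) (h : HypGroup n) (p q : Fin m) :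
    key φ h p < key φ h q ↔
      h.perm (φ p) < h.perm (φ q) ∨ (φ p = φ q ∧ signedLT (h.label (φ p)) p q) := by
  rw [Prod.Lex.lt_iff]
  simp only [key, ofLex_toLex, EmbeddingLike.apply_eq_iff_eq, signedLT]
  refine or_congr_right (and_congr_right fun hpq => ?_)
  rw [← hpq]
  split_ifs
  · rfl
  · exact Fin.rev_lt_rev

lemma pull_perm_lt_iff (φ : Fin m →o Fin n) (h : HypGroup n) (p q : Fin m) :
    (pull φ h).perm p < (pull φ h).perm q ↔
      h.perm (φ p) < h.perm (φ q) ∨ (φ p = φ q ∧ signedLT (h.label (φ p)) p q) := by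
  rw [← key_lt_iff]
  have hs : StrictMono (key φ h ∘ Tuple.sort (key φ h)) :=
    (Tuple.monotone_sort _).strictMono_of_injective
      ((key_injective φ h).comp (Equiv.injective _))
  have := hs.lt_iff_lt (a := (pull φ h).perm p) (b := (pull φ h).perm q)
  rw [← this]
  simp [pull]

@[simp] lemma pull_label (φ : Fin m →o Fin n) (h : HypGroup n) (p : Fin m) :
    (pull φ h).label p = h.label (φ p) := rfl

@[simp] lemma push_pull (φ : Fin m →o Fin n) (h : HypGroup n) (p : Fin m) :
    push h φ ((pull φ h).perm p) = h.perm (φ p) := by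
  change h.perm (φ (Tuple.sort (key φ h) ((Tuple.sort (key φ h))⁻¹ p))) = _
  simp

lemma signedLT_irrefl (e : C2) (p : Fin m) : ¬ signedLT e p p := by
  simp [signedLT]

lemma signedLT_pull_iff (e : C2) (φ : Fin m →o Fin n) (h : HypGroup n) (p q : Fin m) :
    signedLT e ((pull φ h).perm p) ((pull φ h).perm q) ↔
      signedLT e (h.perm (φ p)) (h.perm (φ q)) ∨
        (φ p = φ q ∧ signedLT (e * h.label (φ p)) p q) := by
  rcases Int.units_eq_one_or e with rfl | rfl
  · simp only [signedLT_one, one_mul, pull_perm_lt_iff]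
  · simp only [signedLT_neg_one, pull_perm_lt_iff, eq_comm (a := φ q)]
    refine or_congr_right (and_congr_right fun hpq => ?_)
    rw [← hpq]
    rcases Int.units_eq_one_or (h.label (φ p)) with h' | h' <;>
      simp [h', signedLT_one, signedLT_neg_one]

lemma perm_ext_of_lt {σ τ : Equiv.Perm (Fin m)}
    (h : ∀ p q, σ p < σ q ↔ τ p < τ q) : σ = τ := by
  have hm : StrictMono (σ * τ⁻¹) := by
    intro p q hpq
    simpa [h] using hpq
  have : σ * τ⁻¹ = 1 := (Equiv.Perm.monotone_iff _).1 hm.monotone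
  exact mul_inv_eq_one.1 this

end Crossed

/-! ### The hyperoctahedral category -/

/-- The objects `[len] = {0, …, len}` of the hyperoctahedral category. -/
structure DeltaH : Type where
  len : ℕ

namespace DeltaH

/-- A morphism `[n] ⟶ [m]` is a pair of an order-preserving map and an element of the
hyperoctahedral group of degree `n + 1`. -/
structure Hom (X Y : DeltaH) : Type where
  map : Fin (X.len + 1) →o Fin (Y.len + 1)
  grp : HypGroup (X.len + 1)

/-- The identity morphism. -/
def Hom.id (X : DeltaH) : Hom X X := ⟨OrderHom.id, 1⟩

/-- `(ψ, h) ∘ (φ, g) = (ψ ∘ h_* φ, φ^* h * g)`. -/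
def Hom.comp {X Y Z : DeltaH} (f : Hom X Y) (g : Hom Y Z) : Hom X Z :=
  ⟨g.map.comp (push g.grp f.map), pull f.map g.grp * f.grp⟩

lemma Hom.ext_of {X Y : DeltaH} {f g : Hom X Y}
    (h1 : ∀ i, f.map (f.grp.perm i) = g.map (g.grp.perm i))
    (h2 : ∀ i, f.grp.label i = g.grp.label i)
    (h3 : ∀ i j, f.grp.perm i < f.grp.perm j ↔ g.grp.perm i < g.grp.perm j) : f = g := by
  obtain ⟨φ, z, σ⟩ := f
  obtain ⟨ψ, w, τ⟩ := g
  obtain rfl : σ = τ := perm_ext_of_lt h3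
  obtain rfl : z = w := funext h2
  obtain rfl : φ = ψ := by
    ext p
    simpa using congrArg Fin.val (h1 (σ.symm p))
  rfl

instance : Category DeltaH where
  Hom := Hom
  id := Hom.id
  comp := Hom.comp
  id_comp f := by
    refine Hom.ext_of ?_ ?_ ?_
    · intro i; simp [Hom.comp, Hom.id]
    · intro i; simp [Hom.comp, Hom.id]
    · intro i j
      simp only [Hom.comp, Hom.id, mul_one,
        pull_perm_lt_iff, OrderHom.id_coe, id_eq, or_iff_left_iff_imp, and_imp]
      rintro rfl h
      exact absurd h (signedLT_irrefl _ _)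
  comp_id f := by
    refine Hom.ext_of ?_ ?_ ?_
    · intro i; simp [Hom.comp, Hom.id]
    · intro i; simp [Hom.comp, Hom.id]
    · intro i j
      simp only [Hom.comp, Hom.id, HypGroup.mul_perm, Equiv.Perm.mul_apply, pull_perm_lt_iff,
        HypGroup.one_perm, Equiv.Perm.one_apply, HypGroup.one_label, signedLT_one]
      refine ⟨?_, fun h => ?_⟩
      · rintro (h | h)
        · exact lt_of_not_ge fun h' => absurd (f.map.monotone h') (not_le.2 h)
        · exact h.2
      · rcases (f.map.monotone h.le).lt_or_eq with h' | h'
        · exact Or.inl h'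
        · exact Or.inr ⟨h', h⟩
  assoc f g h := by
    refine Hom.ext_of ?_ ?_ ?_
    · intro i; simp [Hom.comp]
    · intro i; simp [Hom.comp, mul_assoc]
    · intro i j
      simp only [Hom.comp, HypGroup.mul_perm, Equiv.Perm.mul_apply, pull_perm_lt_iff,
        OrderHom.comp_coe, Function.comp_apply, push_pull, HypGroup.mul_label, pull_label,
        signedLT_pull_iff]
      generalize f.grp.perm i = p
      generalize f.grp.perm j = q
      by_cases hpq : f.map p = f.map q
      · simp [hpq, signedLT_irrefl]
      · simp [hpq]

end DeltaH

/-! ### Involutive algebras and the hyperoctahedral bar construction -/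

/-- An involution on the `k`-algebra `A`: an anti-homomorphism of `k`-algebras from `A` to itself
whose square is the identity. -/
structure Involution (k : Type*) (A : Type*) [CommRing k] [Ring A] [Algebra k A] extends
    A →ₗ[k] A where
  map_one' : toFun 1 = 1
  map_mul' : ∀ a b, toFun (a * b) = toFun b * toFun a
  involutive' : ∀ a, toFun (toFun a) = a

namespace Involution

variable {k A : Type*} [CommRing k] [Ring A] [Algebra k A] (ι : Involution k A)

/-- `a ^ z`, which is `a` for `z = 1` and the conjugate of `a` for `z = t`. -/
def act (z : C2) : A →ₗ[k] A := if z = 1 then LinearMap.id else ι.toLinearMap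

@[simp] lemma act_one_left (a : A) : ι.act 1 a = a := by simp [act]
lemma act_neg_one_left (a : A) : ι.act (-1) a = ι.toLinearMap a := by
  simp [act]

lemma act_mul_left (z w : C2) (a : A) : ι.act (z * w) a = ι.act z (ι.act w a) := by
  rcases Int.units_eq_one_or z with rfl | rfl <;> rcases Int.units_eq_one_or w with rfl | rfl <;>
    simp [act_neg_one_left]
  exact (ι.involutive' a).symm

lemma act_list_prod (z : C2) (l : List A) :
    ι.act z l.prod = ((if z = 1 then l else l.reverse).map (ι.act z)).prod := by
  rcases Int.units_eq_one_or z with rfl | rfl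
  · simp [act]
  · rw [if_neg (by decide)]
    induction l with
    | nil => simpa [act_neg_one_left] using ι.map_one'
    | cons a l ih =>
      rw [List.prod_cons, List.reverse_cons, List.map_append, List.prod_append, ← ih]
      simpa [act_neg_one_left] using ι.map_mul' a l.prod

end Involution

section Fibre

variable {m n r : ℕ}

/-- The fibre of `φ` over `j`, listed in increasing order. -/
def fibre (φ : Fin m →o Fin n) (j : Fin n) : List (Fin m) :=
  (List.finRange m).filter fun p => φ p = j

@[simp] lemma mem_fibre {φ : Fin m →o Fin n} {j : Fin n} {p : Fin m} :
    p ∈ fibre φ j ↔ φ p = j := by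
  simp [fibre]

lemma fibre_pairwise (φ : Fin m →o Fin n) (j : Fin n) : (fibre φ j).Pairwise (· < ·) :=
  (List.pairwise_lt_finRange m).filter _

lemma fibre_nodup (φ : Fin m →o Fin n) (j : Fin n) : (fibre φ j).Nodup :=
  (List.nodup_finRange m).filter _

lemma fibre_comp (φ : Fin m →o Fin n) (h : HypGroup n) (ψ : Fin n →o Fin r) (l : Fin r) :
    ((fibre (ψ.comp (push h φ)) l).map fun p => (pull φ h).perm⁻¹ p) =
      (fibre ψ l).flatMap fun q =>
        if h.label (h.perm⁻¹ q) = 1 then fibre φ (h.perm⁻¹ q)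
        else (fibre φ (h.perm⁻¹ q)).reverse := by
  have hmem : ∀ (q : Fin n) (p : Fin m),
      (p ∈ if h.label (h.perm⁻¹ q) = 1 then fibre φ (h.perm⁻¹ q)
        else (fibre φ (h.perm⁻¹ q)).reverse) ↔ h.perm (φ p) = q := by
    intro q p
    rw [← Equiv.Perm.eq_inv_iff_eq]
    split_ifs <;> simp
  have h1 : ((fibre (ψ.comp (push h φ)) l).map fun p => (pull φ h).perm⁻¹ p).Pairwise
      (fun p q => (pull φ h).perm p < (pull φ h).perm q) := by
    rw [List.pairwise_map]
    exact (fibre_pairwise _ _).imp (by simp)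
  have h2 : ((fibre ψ l).flatMap fun q =>
        if h.label (h.perm⁻¹ q) = 1 then fibre φ (h.perm⁻¹ q)
        else (fibre φ (h.perm⁻¹ q)).reverse).Pairwise
      (fun p q => (pull φ h).perm p < (pull φ h).perm q) := by
    rw [List.pairwise_flatMap]
    constructor
    · intro q _
      split_ifs with hl
      · refine (fibre_pairwise _ _).imp_of_mem fun {a b} ha hb hab => ?_
        rw [mem_fibre] at ha hb
        rw [pull_perm_lt_iff]
        exact Or.inr ⟨ha.trans hb.symm, by rw [ha, hl]; exact (signedLT_one _ _).2 hab⟩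
      · rw [List.pairwise_reverse]
        refine (fibre_pairwise _ _).imp_of_mem fun {a b} ha hb hab => ?_
        rw [mem_fibre] at ha hb
        rw [pull_perm_lt_iff]
        refine Or.inr ⟨hb.trans ha.symm, ?_⟩
        rw [hb, (Int.units_eq_one_or _).resolve_left hl]
        exact (signedLT_neg_one _ _).2 hab
    · refine (fibre_pairwise _ _).imp fun {a b} hab p hp q hq => ?_
      rw [hmem] at hp hq
      rw [pull_perm_lt_iff]
      exact Or.inl (by rw [hp, hq]; exact hab)
  refine List.Perm.eq_of_pairwise (le := fun p q => (pull φ h).perm p < (pull φ h).perm q)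
    (fun a b _ _ hab hba => absurd hab hba.asymm) h1 h2 ?_
  refine (List.perm_ext_iff_of_nodup (h1.imp fun h e => ?_) (h2.imp fun h e => ?_)).2 fun p => ?_
  · subst e; exact lt_irrefl _ h
  · subst e; exact lt_irrefl _ h
  · simp only [List.mem_map, mem_fibre, List.mem_flatMap, hmem]
    constructor
    · rintro ⟨q, hq, rfl⟩
      exact ⟨_, by rw [← hq, ← push_pull]; simp, rfl⟩
    · rintro ⟨q, hq, rfl⟩
      exact ⟨(pull φ h).perm p, by simpa using hq, by simp⟩

end Fibre

section BarFactor

variable {k A : Type*} [CommRing k] [Ring A] [Algebra k A] (ι : Involution k A) {m n r : ℕ}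

/-- The ordered product, over the fibre of `φ ∘ σ` above `j`, of the elements `a i ^ z i`, where
`g = (z; σ)`; the order is that of the points `σ i`. -/
def barFactor (φ : Fin m →o Fin n) (g : HypGroup m) (a : Fin m → A) (j : Fin n) : A :=
  ((fibre φ j).map fun p => ι.act (g.label (g.perm⁻¹ p)) (a (g.perm⁻¹ p))).prod

lemma barFactor_id (a : Fin m → A) (j : Fin m) : barFactor ι OrderHom.id 1 a j = a j := by
  have : fibre (OrderHom.id : Fin m →o Fin m) j = [j] := by
    refine List.Perm.eq_singleton ?_
    exact (List.perm_ext_iff_of_nodup (fibre_nodup _ _) (List.nodup_singleton _)).2 (by simp)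
  simp [barFactor, this]

lemma barFactor_comp (φ : Fin m →o Fin n) (g : HypGroup m) (ψ : Fin n →o Fin r) (h : HypGroup n)
    (a : Fin m → A) (l : Fin r) :
    barFactor ι (ψ.comp (push h φ)) (pull φ h * g) a l =
      barFactor ι ψ h (barFactor ι φ g a) l := by
  set c : Fin m → A := fun p =>
    ι.act (h.label (φ p)) (ι.act (g.label (g.perm⁻¹ p)) (a (g.perm⁻¹ p))) with hc
  have h1 : barFactor ι (ψ.comp (push h φ)) (pull φ h * g) a l =
      (((fibre (ψ.comp (push h φ)) l).map fun p => (pull φ h).perm⁻¹ p).map c).prod := by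
    rw [List.map_map]
    simp only [barFactor, hc, ← ι.act_mul_left]
    congr 1
    refine List.map_congr_left fun p _ => ?_
    simp [mul_inv_rev]
  rw [h1, fibre_comp, List.map_flatMap, List.flatMap_def, List.prod_flatten, List.map_map]
  rw [barFactor]
  congr 1
  refine List.map_congr_left fun q _ => ?_
  rw [Function.comp_apply, barFactor, ι.act_list_prod]
  congr 1
  split_ifs with hl
  · rw [List.map_map]
    refine List.map_congr_left fun p hp => ?_
    rw [mem_fibre] at hp
    simp [hc, hp]
  · rw [← List.map_reverse, List.map_map]
    refine List.map_congr_left fun p hp => ?_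
    rw [List.mem_reverse, mem_fibre] at hp
    simp [hc, hp]

/-- The factor at `j` depends on `a i` only if `i` lies above `j`. -/
lemma barFactor_update_of_ne [DecidableEq (Fin m)] (φ : Fin m →o Fin n) (g : HypGroup m)
    (a : Fin m → A) (i : Fin m) (x : A) (j : Fin n) (hj : j ≠ φ (g.perm i)) :
    barFactor ι φ g (Function.update a i x) j = barFactor ι φ g a j := by
  rw [barFactor, barFactor]
  congr 1
  refine List.map_congr_left fun p hp => ?_
  rw [mem_fibre] at hp
  have : g.perm⁻¹ p ≠ i := by
    rintro rfl
    exact hj (by simp [hp])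
  rw [Function.update_of_ne this]

/-- The factor above which `i` lies depends linearly on `a i`. -/
lemma barFactor_update_eq [DecidableEq (Fin m)] (φ : Fin m →o Fin n) (g : HypGroup m)
    (a : Fin m → A) (i : Fin m) :
    ∃ b c : A, ∀ x, barFactor ι φ g (Function.update a i x) (φ (g.perm i)) =
      b * ι.act (g.label i) x * c := by
  have hi : g.perm i ∈ fibre φ (φ (g.perm i)) := by simp
  obtain ⟨l₁, l₂, hl⟩ := List.append_of_mem hi
  have hnd := fibre_nodup φ (φ (g.perm i))
  rw [hl, List.nodup_middle, List.nodup_cons, List.mem_append, not_or] at hnd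
  refine ⟨(l₁.map fun p => ι.act (g.label (g.perm⁻¹ p)) (a (g.perm⁻¹ p))).prod,
    (l₂.map fun p => ι.act (g.label (g.perm⁻¹ p)) (a (g.perm⁻¹ p))).prod, fun x => ?_⟩
  have hkey : ∀ l : List (Fin m), g.perm i ∉ l →
      (l.map fun p => ι.act (g.label (g.perm⁻¹ p)) (Function.update a i x (g.perm⁻¹ p))) =
        l.map fun p => ι.act (g.label (g.perm⁻¹ p)) (a (g.perm⁻¹ p)) := by
    intro l hl'
    refine List.map_congr_left fun p hp => ?_
    rw [Function.update_of_ne]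
    rintro rfl
    exact hl' (by simpa using hp)
  rw [barFactor, hl, List.map_append, List.map_cons, List.prod_append, List.prod_cons,
    hkey _ hnd.1.1, hkey _ hnd.1.2]
  simp [mul_assoc]

lemma barFactor_update_add [DecidableEq (Fin m)] (φ : Fin m →o Fin n) (g : HypGroup m)
    (a : Fin m → A) (i : Fin m) (x y : A) :
    barFactor ι φ g (Function.update a i (x + y)) (φ (g.perm i)) =
      barFactor ι φ g (Function.update a i x) (φ (g.perm i)) +
        barFactor ι φ g (Function.update a i y) (φ (g.perm i)) := by
  obtain ⟨b, c, h⟩ := barFactor_update_eq ι φ g a i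
  simp only [h, map_add, mul_add, add_mul]

lemma barFactor_update_smul [DecidableEq (Fin m)] (φ : Fin m →o Fin n) (g : HypGroup m)
    (a : Fin m → A) (i : Fin m) (s : k) (x : A) :
    barFactor ι φ g (Function.update a i (s • x)) (φ (g.perm i)) =
      s • barFactor ι φ g (Function.update a i x) (φ (g.perm i)) := by
  obtain ⟨b, c, h⟩ := barFactor_update_eq ι φ g a i
  simp only [h, map_smul, Algebra.mul_smul_comm, Algebra.smul_mul_assoc]

end BarFactor

universe u v w

section BarConstruction

variable {k : Type u} {A : Type v} [CommRing k] [Ring A] [Algebra k A]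

/-- The map `a ↦ ⨂ j, barFactor a j`, as a multilinear map. -/
def barMultilinear (ι : Involution k A) {m n : ℕ} (φ : Fin m →o Fin n) (g : HypGroup m) :
    MultilinearMap k (fun _ : Fin m => A) (⨂[k] _ : Fin n, A) where
  toFun a := PiTensorProduct.tprod k (barFactor ι φ g a)
  map_update_add' a i x y := by
    have h : ∀ z, barFactor ι φ g (Function.update a i z) =
        Function.update (barFactor ι φ g a) (φ (g.perm i))
          (barFactor ι φ g (Function.update a i z) (φ (g.perm i))) := fun z =>
      Function.eq_update_iff.2 ⟨rfl, fun j hj => barFactor_update_of_ne ι φ g a i z j hj⟩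
    rw [h, h x, h y, barFactor_update_add, MultilinearMap.map_update_add]
  map_update_smul' a i s x := by
    have h : ∀ z, barFactor ι φ g (Function.update a i z) =
        Function.update (barFactor ι φ g a) (φ (g.perm i))
          (barFactor ι φ g (Function.update a i z) (φ (g.perm i))) := fun z =>
      Function.eq_update_iff.2 ⟨rfl, fun j hj => barFactor_update_of_ne ι φ g a i z j hj⟩
    rw [h, h x, barFactor_update_smul, MultilinearMap.map_update_smul]

/-- The linear map `A^{⊗ m} → A^{⊗ n}` induced by `(φ, g)`. -/
def barMap (ι : Involution k A) {m n : ℕ} (φ : Fin m →o Fin n) (g : HypGroup m) :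
    (⨂[k] _ : Fin m, A) →ₗ[k] ⨂[k] _ : Fin n, A :=
  PiTensorProduct.lift (barMultilinear ι φ g)

@[simp] lemma barMap_tprod (ι : Involution k A) {m n : ℕ} (φ : Fin m →o Fin n) (g : HypGroup m)
    (a : Fin m → A) :
    barMap ι φ g (PiTensorProduct.tprod k a) = PiTensorProduct.tprod k (barFactor ι φ g a) := by
  rw [barMap, PiTensorProduct.lift.tprod]
  rfl

/-- The hyperoctahedral bar construction `H_A : ΔH ⥤ Mod_k`, with `H_A [n] = A^{⊗ (n + 1)}`. -/
def barConstruction (ι : Involution k A) : DeltaH ⥤ ModuleCat.{max u v} k where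
  obj X := ModuleCat.of k (⨂[k] _ : Fin (X.len + 1), A)
  map f := ModuleCat.ofHom (barMap ι f.map f.grp)
  map_id X := by
    refine ModuleCat.hom_ext (PiTensorProduct.ext (MultilinearMap.ext fun a => ?_))
    refine (barMap_tprod ι _ _ a).trans (congrArg _ (funext fun j => ?_))
    exact barFactor_id ι a j
  map_comp f g := by
    refine ModuleCat.hom_ext (PiTensorProduct.ext (MultilinearMap.ext fun a => ?_))
    refine (barMap_tprod ι _ _ a).trans ?_
    refine Eq.trans ?_ (congrArg (barMap ι g.map g.grp) (barMap_tprod ι f.map f.grp a)).symm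
    rw [barMap_tprod]
    exact congrArg _ (funext fun j => barFactor_comp ι f.map f.grp g.map g.grp a j)

end BarConstruction

/-! ### Epimorphisms and the augmentation ideal -/

/-- The subcategory of `ΔH` with all objects and with the epimorphisms as morphisms. -/
abbrev EpiDeltaH : Type := WideSubcategory (MorphismProperty.epimorphisms DeltaH)

/-- The inclusion of the subcategory of epimorphisms. -/
abbrev epiInclusion : EpiDeltaH ⥤ DeltaH :=
  wideSubcategoryInclusion (MorphismProperty.epimorphisms DeltaH)

/-- An epimorphism of `ΔH` is surjective: otherwise the identity and the change of label at a point
outside the image would agree after composition. -/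
lemma DeltaH.surjective_of_epi {X Y : DeltaH} (f : X ⟶ Y) [Epi f] :
    Function.Surjective f.map := by
  by_contra hf
  obtain ⟨j, hj⟩ := not_forall.1 hf
  have hj' : ∀ p, f.map p ≠ j := fun p hp => hj ⟨p, hp⟩
  let t : Y ⟶ Y := ⟨OrderHom.id, ⟨Function.update (fun _ => 1) j (-1), 1⟩⟩
  have hl : ∀ p, t.grp.label (f.map p) = 1 := fun p => by
    change Function.update (fun _ => (1 : C2)) j (-1) (f.map p) = 1
    rw [Function.update_of_ne (hj' p)]
  have h : f ≫ t = f ≫ 𝟙 Y := by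
    refine DeltaH.Hom.ext_of ?_ ?_ ?_
    · intro i
      change push t.grp f.map ((pull f.map t.grp).perm (f.grp.perm i)) =
        push 1 f.map ((pull f.map 1).perm (f.grp.perm i))
      rw [push_pull, push_pull]
      rfl
    · intro i
      change t.grp.label (f.map (f.grp.perm i)) * _ = 1 * _
      rw [hl]
    · intro i i'
      change (pull f.map t.grp).perm (f.grp.perm i) < (pull f.map t.grp).perm (f.grp.perm i') ↔
        (pull f.map 1).perm (f.grp.perm i) < (pull f.map 1).perm (f.grp.perm i')
      rw [pull_perm_lt_iff, pull_perm_lt_iff, hl]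
      rfl
  have h' : t = 𝟙 Y := (cancel_epi f).1 h
  have : t.grp.label j = 1 := by rw [h']; rfl
  simp [t] at this

lemma EpiDeltaH.surjective {X Y : EpiDeltaH} (f : X ⟶ Y) : Function.Surjective f.hom.map :=
  haveI : Epi f.hom := f.property
  DeltaH.surjective_of_epi f.hom

/-- The structure of an augmented involutive `k`-algebra on `A`: an involution and a homomorphism of
`k`-algebras `aug : A → k` that is compatible with the involution, where `k` has the trivial one. -/
structure AugmentedInvolution (k : Type*) (A : Type*) [CommRing k] [Ring A] [Algebra k A] extends
    Involution k A where
  aug : A →ₐ[k] k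
  aug_toFun : ∀ a, aug (toFun a) = aug a

section AugmentationIdeal

variable {k : Type u} {A : Type v} [CommRing k] [Ring A] [Algebra k A]
  (α : AugmentedInvolution k A)

/-- The augmentation ideal, as a `k`-module. -/
def AugmentedInvolution.ideal : Submodule k A := LinearMap.ker α.aug.toLinearMap

@[simp] lemma AugmentedInvolution.mem_ideal {a : A} : a ∈ α.ideal ↔ α.aug a = 0 := Iff.rfl

lemma AugmentedInvolution.aug_act (z : C2) (a : A) : α.aug (α.toInvolution.act z a) = α.aug a := by
  rcases Int.units_eq_one_or z with rfl | rfl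
  · simp
  · rw [Involution.act_neg_one_left]
    exact α.aug_toFun a

lemma barFactor_mem_ideal {m n : ℕ} (φ : Fin m →o Fin n) (hφ : Function.Surjective φ)
    (g : HypGroup m) (a : Fin m → A) (ha : ∀ i, a i ∈ α.ideal) (j : Fin n) :
    barFactor α.toInvolution φ g a j ∈ α.ideal := by
  obtain ⟨p, rfl⟩ := hφ j
  rw [AugmentedInvolution.mem_ideal, barFactor, map_list_prod]
  refine List.prod_eq_zero ?_
  rw [List.map_map, List.mem_map]
  exact ⟨p, by simp, by simpa [AugmentedInvolution.aug_act] using ha (g.perm⁻¹ p)⟩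

/-- `barFactor` for a surjection, on elements of the augmentation ideal. -/
def idealFactor {m n : ℕ} (φ : Fin m →o Fin n) (hφ : Function.Surjective φ) (g : HypGroup m)
    (a : Fin m → α.ideal) (j : Fin n) : α.ideal :=
  ⟨barFactor α.toInvolution φ g (fun i => a i) j,
    barFactor_mem_ideal α φ hφ g _ (fun i => (a i).2) j⟩

lemma coe_update {m : ℕ} [DecidableEq (Fin m)] (a : Fin m → α.ideal) (i : Fin m) (x : α.ideal) :
    (fun l => (Function.update a i x l : A)) = Function.update (fun l => (a l : A)) i x := by
  funext l
  by_cases h : l = i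
  · subst h; simp
  · simp [h]

lemma idealFactor_update {m n : ℕ} [DecidableEq (Fin m)] (φ : Fin m →o Fin n)
    (hφ : Function.Surjective φ) (g : HypGroup m) (a : Fin m → α.ideal) (i : Fin m) (x : α.ideal) :
    idealFactor α φ hφ g (Function.update a i x) =
      Function.update (idealFactor α φ hφ g a) (φ (g.perm i))
        (idealFactor α φ hφ g (Function.update a i x) (φ (g.perm i))) := by
  refine Function.eq_update_iff.2 ⟨rfl, fun j hj => Subtype.ext ?_⟩
  simp only [idealFactor, coe_update]
  exact barFactor_update_of_ne _ φ g _ i _ j hj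

/-- The map `a ↦ ⨂ j, idealFactor a j`, as a multilinear map. -/
def idealMultilinear {m n : ℕ} (φ : Fin m →o Fin n) (hφ : Function.Surjective φ)
    (g : HypGroup m) :
    MultilinearMap k (fun _ : Fin m => α.ideal) (⨂[k] _ : Fin n, α.ideal) where
  toFun a := PiTensorProduct.tprod k (idealFactor α φ hφ g a)
  map_update_add' a i x y := by
    have h : idealFactor α φ hφ g (Function.update a i (x + y)) (φ (g.perm i)) =
        idealFactor α φ hφ g (Function.update a i x) (φ (g.perm i)) +
          idealFactor α φ hφ g (Function.update a i y) (φ (g.perm i)) := by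
      refine Subtype.ext ?_
      simp only [idealFactor, coe_update, Submodule.coe_add]
      exact barFactor_update_add _ φ g _ i _ _
    rw [idealFactor_update, h, MultilinearMap.map_update_add, ← idealFactor_update,
      ← idealFactor_update]
  map_update_smul' a i s x := by
    have h : idealFactor α φ hφ g (Function.update a i (s • x)) (φ (g.perm i)) =
        s • idealFactor α φ hφ g (Function.update a i x) (φ (g.perm i)) := by
      refine Subtype.ext ?_
      simp only [idealFactor, coe_update, Submodule.coe_smul]
      exact barFactor_update_smul _ φ g _ i _ _
    rw [idealFactor_update, h, MultilinearMap.map_update_smul, ← idealFactor_update]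

/-- The linear map `I^{⊗ m} → I^{⊗ n}` induced by `(φ, g)` with `φ` surjective. -/
def idealMap {m n : ℕ} (φ : Fin m →o Fin n) (hφ : Function.Surjective φ) (g : HypGroup m) :
    (⨂[k] _ : Fin m, α.ideal) →ₗ[k] ⨂[k] _ : Fin n, α.ideal :=
  PiTensorProduct.lift (idealMultilinear α φ hφ g)

@[simp] lemma idealMap_tprod {m n : ℕ} (φ : Fin m →o Fin n) (hφ : Function.Surjective φ)
    (g : HypGroup m) (a : Fin m → α.ideal) :
    idealMap α φ hφ g (PiTensorProduct.tprod k a) =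
      PiTensorProduct.tprod k (idealFactor α φ hφ g a) := by
  rw [idealMap, PiTensorProduct.lift.tprod]
  rfl

/-- The functor `H_I : EpiΔH ⥤ Mod_k`, with `H_I [n] = I^{⊗ (n + 1)}` and with the action of
morphisms given by the formula for `H_A`. -/
def idealConstruction : EpiDeltaH ⥤ ModuleCat.{max u v} k where
  obj X := ModuleCat.of k (⨂[k] _ : Fin (X.obj.len + 1), α.ideal)
  map f := ModuleCat.ofHom (idealMap α f.hom.map (EpiDeltaH.surjective f) f.hom.grp)
  map_id X := by
    refine ModuleCat.hom_ext (PiTensorProduct.ext (MultilinearMap.ext fun a => ?_))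
    refine (idealMap_tprod α _ _ _ a).trans (congrArg _ (funext fun j => Subtype.ext ?_))
    exact barFactor_id α.toInvolution (fun i => (a i : A)) j
  map_comp f g := by
    refine ModuleCat.hom_ext (PiTensorProduct.ext (MultilinearMap.ext fun a => ?_))
    refine (idealMap_tprod α _ _ _ a).trans ?_
    refine Eq.trans ?_ (congrArg (idealMap α g.hom.map (EpiDeltaH.surjective g) g.hom.grp)
      (idealMap_tprod α f.hom.map (EpiDeltaH.surjective f) f.hom.grp a)).symm
    rw [idealMap_tprod]
    exact congrArg _ (funext fun j => Subtype.ext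
      (barFactor_comp α.toInvolution f.hom.map f.hom.grp g.hom.map g.hom.grp
        (fun i => (a i : A)) j))

/-- The natural map `I^{⊗ (n + 1)} → A^{⊗ (n + 1)}` from `H_I` to the restriction of `H_A`. -/
def idealToBar : idealConstruction α ⟶ epiInclusion ⋙ barConstruction α.toInvolution where
  app X := ModuleCat.ofHom (PiTensorProduct.mapIncl fun _ : Fin (X.obj.len + 1) => α.ideal)
  naturality X Y f := by
    refine ModuleCat.hom_ext (PiTensorProduct.ext (MultilinearMap.ext fun a => ?_))
    change PiTensorProduct.mapIncl _ (idealMap α _ (EpiDeltaH.surjective f) _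
        (PiTensorProduct.tprod k a)) =
      barMap α.toInvolution f.hom.map f.hom.grp
        (PiTensorProduct.mapIncl _ (PiTensorProduct.tprod k a))
    simp only [PiTensorProduct.mapIncl, idealMap_tprod, PiTensorProduct.map_tprod, barMap_tprod]
    rfl

end AugmentationIdeal

/-! ### Functor homology -/

section FunctorHomology

variable {k : Type u} [CommRing k] {C : Type} [SmallCategory C]

open Classical in
/-- The relations `G(α)(x) ⊗ y - x ⊗ F(α)(y)` that define the tensor product of a right and a left
`C`-module. -/
def tensorRel (G : Cᵒᵖ ⥤ ModuleCat.{u} k) (F : C ⥤ ModuleCat.{w} k) :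
    Submodule k (⨁ c : C, G.obj (op c) ⊗[k] F.obj c) :=
  Submodule.span k {t | ∃ (c c' : C) (f : c ⟶ c') (x : G.obj (op c')) (y : F.obj c),
    t = DirectSum.lof k C (fun c => G.obj (op c) ⊗[k] F.obj c) c (G.map f.op x ⊗ₜ[k] y) -
      DirectSum.lof k C (fun c => G.obj (op c) ⊗[k] F.obj c) c' (x ⊗ₜ[k] F.map f y)}

/-- The tensor product `G ⊗_C F` of a right `C`-module `G` and a left `C`-module `F`. -/
abbrev TensorOver (G : Cᵒᵖ ⥤ ModuleCat.{u} k) (F : C ⥤ ModuleCat.{w} k) : Type (max u w) :=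
  (⨁ c : C, G.obj (op c) ⊗[k] F.obj c) ⧸ tensorRel G F

namespace TensorOver

open Classical in
/-- The class `[x ⊗ y]`. -/
def mk (G : Cᵒᵖ ⥤ ModuleCat.{u} k) (F : C ⥤ ModuleCat.{w} k) (c : C) :
    G.obj (op c) →ₗ[k] F.obj c →ₗ[k] TensorOver G F :=
  LinearMap.compr₂ (TensorProduct.mk k (G.obj (op c)) (F.obj c))
    ((tensorRel G F).mkQ ∘ₗ DirectSum.lof k C (fun c => G.obj (op c) ⊗[k] F.obj c) c)

lemma mk_map {G : Cᵒᵖ ⥤ ModuleCat.{u} k} {F : C ⥤ ModuleCat.{w} k} {c c' : C} (f : c ⟶ c')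
    (x : G.obj (op c')) (y : F.obj c) :
    mk G F c (G.map f.op x) y = mk G F c' x (F.map f y) :=
  (Submodule.Quotient.eq _).2 (Submodule.subset_span ⟨c, c', f, x, y, rfl⟩)

lemma hom_ext {G : Cᵒᵖ ⥤ ModuleCat.{u} k} {F : C ⥤ ModuleCat.{w} k} {M : Type*}
    [AddCommGroup M] [Module k M] {f g : TensorOver G F →ₗ[k] M}
    (h : ∀ c x y, f (mk G F c x y) = g (mk G F c x y)) : f = g := by
  classical
  refine Submodule.linearMap_qext _ (DirectSum.linearMap_ext k fun c => ?_)
  exact TensorProduct.ext' fun x y => h c x y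

open Classical in
/-- The universal property of `G ⊗_C F`. -/
def desc {G : Cᵒᵖ ⥤ ModuleCat.{u} k} {F : C ⥤ ModuleCat.{w} k} {M : Type*}
    [AddCommGroup M] [Module k M] (φ : ∀ c : C, G.obj (op c) →ₗ[k] F.obj c →ₗ[k] M)
    (hφ : ∀ {c c' : C} (f : c ⟶ c') (x : G.obj (op c')) (y : F.obj c),
      φ c (G.map f.op x) y = φ c' x (F.map f y)) : TensorOver G F →ₗ[k] M :=
  (tensorRel G F).liftQ (DirectSum.toModule k C M fun c => TensorProduct.lift (φ c)) <| by
    refine Submodule.span_le.2 ?_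
    rintro _ ⟨c, c', f, x, y, rfl⟩
    simp only [SetLike.mem_coe, LinearMap.mem_ker, map_sub, DirectSum.toModule_lof,
      TensorProduct.lift.tmul, hφ, sub_self]

@[simp] lemma desc_mk {G : Cᵒᵖ ⥤ ModuleCat.{u} k} {F : C ⥤ ModuleCat.{w} k} {M : Type*}
    [AddCommGroup M] [Module k M] (φ : ∀ c : C, G.obj (op c) →ₗ[k] F.obj c →ₗ[k] M)
    (hφ : ∀ {c c' : C} (f : c ⟶ c') (x : G.obj (op c')) (y : F.obj c),
      φ c (G.map f.op x) y = φ c' x (F.map f y)) (c : C) (x : G.obj (op c)) (y : F.obj c) :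
    desc φ hφ (mk G F c x y) = φ c x y := by
  classical
  change DirectSum.toModule k C M (fun c => TensorProduct.lift (φ c))
    (DirectSum.lof k C (fun c => G.obj (op c) ⊗[k] F.obj c) c (x ⊗ₜ[k] y)) = _
  rw [DirectSum.toModule_lof, TensorProduct.lift.tmul]

end TensorOver

lemma tensorMap_aux (F : C ⥤ ModuleCat.{w} k) {G G' : Cᵒᵖ ⥤ ModuleCat.{u} k} (θ : G ⟶ G')
    {c c' : C} (f : c ⟶ c') (x : G.obj (op c')) (y : F.obj c) :
    (TensorOver.mk G' F c ∘ₗ (θ.app (op c)).hom) (G.map f.op x) y =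
      (TensorOver.mk G' F c' ∘ₗ (θ.app (op c')).hom) x (F.map f y) := by
  have h := congrArg (fun l => l.hom x) (θ.naturality f.op)
  refine Eq.trans ?_ (TensorOver.mk_map f ((θ.app (op c')).hom x) y)
  exact congrArg (fun z => TensorOver.mk G' F c z y) h

/-- The map `[x ⊗ y] ↦ [Θ x ⊗ y]`. -/
def tensorMap (F : C ⥤ ModuleCat.{w} k) {G G' : Cᵒᵖ ⥤ ModuleCat.{u} k} (θ : G ⟶ G') :
    TensorOver G F →ₗ[k] TensorOver G' F :=
  TensorOver.desc (fun c => TensorOver.mk G' F c ∘ₗ (θ.app (op c)).hom) (tensorMap_aux F θ)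

@[simp] lemma tensorMap_mk (F : C ⥤ ModuleCat.{w} k) {G G' : Cᵒᵖ ⥤ ModuleCat.{u} k}
    (θ : G ⟶ G') (c : C) (x : G.obj (op c)) (y : F.obj c) :
    tensorMap F θ (TensorOver.mk G F c x y) = TensorOver.mk G' F c ((θ.app (op c)).hom x) y :=
  TensorOver.desc_mk _ (tensorMap_aux F θ) c x y

/-- The functor `- ⊗_C F`. -/
def tensorFunctor (F : C ⥤ ModuleCat.{w} k) :
    (Cᵒᵖ ⥤ ModuleCat.{u} k) ⥤ ModuleCat.{max u w} k where
  obj G := ModuleCat.of k (TensorOver G F)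
  map θ := ModuleCat.ofHom (tensorMap F θ)
  map_id G := by
    refine ModuleCat.hom_ext (TensorOver.hom_ext fun c x y => ?_)
    exact tensorMap_mk F (𝟙 G) c x y
  map_comp θ θ' := by
    refine ModuleCat.hom_ext (TensorOver.hom_ext fun c x y => ?_)
    refine (tensorMap_mk F (θ ≫ θ') c x y).trans (Eq.symm ?_)
    refine (congrArg (tensorMap F θ') (tensorMap_mk F θ c x y)).trans ?_
    exact tensorMap_mk F θ' c _ y

/-- The free `k`-module functor. -/
def freeModule (k : Type u) [CommRing k] : Type ⥤ ModuleCat.{u} k where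
  obj X := ModuleCat.of k (X →₀ k)
  map f := ModuleCat.ofHom (Finsupp.lmapDomain k k f)
  map_id _ := ModuleCat.hom_ext (Finsupp.lmapDomain_id k k)
  map_comp f g := ModuleCat.hom_ext (Finsupp.lmapDomain_comp k k f g)

/-- The simplicial right `C`-module `k[N_*(- ↓ C)]`. -/
def underNerveModule (k : Type u) [CommRing k] (C : Type) [SmallCategory C] :
    SimplicialObject (Cᵒᵖ ⥤ ModuleCat.{u} k) :=
  (Under.mapFunctor C ⋙ nerveFunctor).flip ⋙ (Functor.whiskeringRight _ _ _).obj (freeModule k)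

/-- The simplicial `k`-module `k[N_*(- ↓ C)] ⊗_C F`. -/
def underNerveTensor (F : C ⥤ ModuleCat.{w} k) : SimplicialObject (ModuleCat.{max u w} k) :=
  underNerveModule k C ⋙ tensorFunctor F

/-- The element `[s ⊗ y]` of `k[N_*(- ↓ C)] ⊗_C F`, for a string `s = (f_n, …, f_1, f_0)`, that is
an element of the nerve of `c ↓ C`, and `y` in `F c`. -/
def underNerveMk (F : C ⥤ ModuleCat.{w} k) (Δ : SimplexCategoryᵒᵖ) (c : C)
    (s : (nerve (Under c)).obj Δ) (y : F.obj c) : (underNerveTensor F).obj Δ :=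
  TensorOver.mk ((underNerveModule k C).obj Δ) F c (Finsupp.single s (1 : k)) y

lemma underNerveTensor_hom_ext {F : C ⥤ ModuleCat.{w} k} {Δ : SimplexCategoryᵒᵖ} {M : Type*}
    [AddCommGroup M] [Module k M] {f g : (underNerveTensor F).obj Δ →ₗ[k] M}
    (h : ∀ c s y, f (underNerveMk F Δ c s y) = g (underNerveMk F Δ c s y)) : f = g := by
  refine TensorOver.hom_ext fun c x y => ?_
  let L : ((nerve (Under c)).obj Δ →₀ k) →ₗ[k] (underNerveTensor F).obj Δ :=
    (TensorOver.mk ((underNerveModule k C).obj Δ) F c).flip y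
  have h' : f ∘ₗ L = g ∘ₗ L :=
    Finsupp.lhom_ext' fun s => LinearMap.ext_ring (h c s y)
  exact congrArg (fun l => l x) h'

lemma underNerveTensor_map_mk (F : C ⥤ ModuleCat.{w} k) {Δ Δ' : SimplexCategoryᵒᵖ} (θ : Δ ⟶ Δ')
    (c : C) (s : (nerve (Under c)).obj Δ) (y : F.obj c) :
    ((underNerveTensor F).map θ).hom (underNerveMk F Δ c s y) =
      underNerveMk F Δ' c ((nerve (Under c)).map θ s) y := by
  refine (tensorMap_mk F ((underNerveModule k C).map θ) c _ y).trans ?_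
  refine congrArg (fun z => TensorOver.mk ((underNerveModule k C).obj Δ') F c z y) ?_
  exact Finsupp.mapDomain_single

/-- The `k`-module `C_n(C, F) = ⨁ F(C_0)`, the sum being over the strings `C_0 → ⋯ → C_n` in the
nerve of `C`. -/
abbrev GZ (F : C ⥤ ModuleCat.{w} k) (Δ : SimplexCategoryᵒᵖ) : Type w :=
  ⨁ s : ComposableArrows C Δ.unop.len, F.obj s.left

namespace GZ

open Classical in
/-- The element `(s, y)` of the summand of the string `s`. -/
def mk (F : C ⥤ ModuleCat.{w} k) (Δ : SimplexCategoryᵒᵖ) (s : ComposableArrows C Δ.unop.len) :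
    F.obj s.left →ₗ[k] GZ F Δ :=
  DirectSum.lof k (ComposableArrows C Δ.unop.len) (fun s => F.obj s.left) s

lemma hom_ext {F : C ⥤ ModuleCat.{w} k} {Δ : SimplexCategoryᵒᵖ} {M : Type*}
    [AddCommGroup M] [Module k M] {f g : GZ F Δ →ₗ[k] M}
    (h : ∀ s y, f (mk F Δ s y) = g (mk F Δ s y)) : f = g := by
  classical
  exact DirectSum.linearMap_ext k fun s => LinearMap.ext fun y => h s y

open Classical in
/-- A simplicial operator `θ` sends the summand of the string `s` to that of `θ^* s`, by the map
that `F` assigns to the arrow from the first object of `s` to the first object of `θ^* s`.  For the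
face map that drops the first object this arrow is `f_1`; for the other faces and for the
degeneracies it is an identity. -/
def map (F : C ⥤ ModuleCat.{w} k) {Δ Δ' : SimplexCategoryᵒᵖ} (θ : Δ ⟶ Δ') : GZ F Δ →ₗ[k] GZ F Δ' :=
  DirectSum.toModule k _ _ fun s => mk F Δ' ((nerve C).map θ s) ∘ₗ
    (F.map (s.map (homOfLE (Fin.zero_le (θ.unop.toOrderHom 0))))).hom

lemma map_mk (F : C ⥤ ModuleCat.{w} k) {Δ Δ' : SimplexCategoryᵒᵖ} (θ : Δ ⟶ Δ')
    (s : ComposableArrows C Δ.unop.len) (y : F.obj s.left) :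
    map F θ (mk F Δ s y) = mk F Δ' ((nerve C).map θ s)
      ((F.map (s.map (homOfLE (Fin.zero_le (θ.unop.toOrderHom 0))))).hom y) := by
  classical
  rw [map, mk, DirectSum.toModule_lof]
  rfl

end GZ

/-- The simplicial `k`-module `C_*(C, F)` of Gabriel and Zisman. -/
def gabrielZisman (F : C ⥤ ModuleCat.{w} k) : SimplicialObject (ModuleCat.{w} k) where
  obj Δ := ModuleCat.of k (GZ F Δ)
  map θ := ModuleCat.ofHom (GZ.map F θ)
  map_id Δ := by
    refine ModuleCat.hom_ext (GZ.hom_ext fun s y => ?_)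
    refine (GZ.map_mk F (𝟙 Δ) s y).trans (congrArg (GZ.mk F Δ s) ?_)
    have h : F.map (s.map (𝟙 0)) = 𝟙 _ := by rw [s.map_id, F.map_id]
    exact congrArg (fun l => l.hom y) h
  map_comp {Δ Δ' Δ''} θ θ' := by
    refine ModuleCat.hom_ext (GZ.hom_ext fun s y => ?_)
    refine (GZ.map_mk F (θ ≫ θ') s y).trans (Eq.symm ?_)
    refine (congrArg (GZ.map F θ') (GZ.map_mk F θ s y)).trans ?_
    refine (GZ.map_mk F θ' _ _).trans ?_
    refine congrArg (GZ.mk F Δ'' ((nerve C).map (θ ≫ θ') s)) ?_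
    have h : F.map (s.map (homOfLE (Fin.zero_le (θ.unop.toOrderHom 0)))) ≫
        F.map (s.map (homOfLE (θ.unop.toOrderHom.monotone
          (Fin.zero_le (θ'.unop.toOrderHom 0))))) =
        F.map (s.map (homOfLE (Fin.zero_le ((θ ≫ θ').unop.toOrderHom 0)))) := by
      rw [← F.map_comp, ← s.map_comp]
      rfl
    exact congrArg (fun l => l.hom y) h

/-! ### Change of category -/

section ChangeOfCategory

variable {D : Type} [SmallCategory D] (J : D ⥤ C) {F' : D ⥤ ModuleCat.{w} k}
  {F : C ⥤ ModuleCat.{w} k} (η : F' ⟶ J ⋙ F)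

lemma under_eqToHom_right {c : C} {X Y : Under c} (h : X = Y) :
    Under.Hom.right (eqToHom h) = eqToHom (congrArg (fun Z : Under c => Z.right) h) := by
  subst h
  rfl

lemma under_map_post {d d' : D} (f : d ⟶ d') :
    Under.map f ⋙ Under.post J = Under.post J ⋙ Under.map (J.map f) := by
  have h : ∀ X, (Under.map f ⋙ Under.post J).obj X = (Under.post J ⋙ Under.map (J.map f)).obj X :=
    fun X => congrArg Under.mk (J.map_comp f X.hom)
  refine CategoryTheory.Functor.ext h (fun X Y g => ?_)
  · refine Under.UnderMorphism.ext ?_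
    rw [Under.comp_right, Under.comp_right, under_eqToHom_right, under_eqToHom_right]
    simp only [Functor.comp_map, Under.post_map, Under.map_map_right, Under.homMk_right]
    exact ((Category.id_comp _).trans (Category.comp_id _)).symm

/-- The map `(f_n, …, f_0) ↦ (J f_n, …, J f_0)` on strings under `d`. -/
def underNerveFreeMap (Δ : SimplexCategoryᵒᵖ) (d : D) :
    ((underNerveModule k D).obj Δ).obj (op d) →ₗ[k]
      ((underNerveModule k C).obj Δ).obj (op (J.obj d)) :=
  Finsupp.lmapDomain k k ((nerveMap (Under.post (X := d) J)).app Δ)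

lemma underNerveFreeMap_map (Δ : SimplexCategoryᵒᵖ) {d d' : D} (f : d ⟶ d')
    (x : ((underNerveModule k D).obj Δ).obj (op d')) :
    underNerveFreeMap J Δ d (((underNerveModule k D).obj Δ).map f.op x) =
      ((underNerveModule k C).obj Δ).map (J.map f).op (underNerveFreeMap J Δ d' x) := by
  refine (Finsupp.mapDomain_comp (v := x)).symm.trans (Eq.trans ?_ (Finsupp.mapDomain_comp (v := x)))
  refine congrArg (fun l => Finsupp.mapDomain l x) (funext fun s => ?_)
  exact congrArg (fun G => (show ComposableArrows (Under d') Δ.unop.len from s) ⋙ G)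
    (under_map_post J f)

lemma underNerveFreeMap_op {Δ Δ' : SimplexCategoryᵒᵖ} (θ : Δ ⟶ Δ') (d : D)
    (x : ((underNerveModule k D).obj Δ).obj (op d)) :
    underNerveFreeMap J Δ' d ((((underNerveModule k D).map θ).app (op d)).hom x) =
      (((underNerveModule k C).map θ).app (op (J.obj d))).hom (underNerveFreeMap J Δ d x) := by
  refine (Finsupp.mapDomain_comp (v := x)).symm.trans (Eq.trans ?_ (Finsupp.mapDomain_comp (v := x)))
  rfl

lemma underNerveTensorMap_aux (Δ : SimplexCategoryᵒᵖ) {d d' : D} (f : d ⟶ d')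
    (x : ((underNerveModule k D).obj Δ).obj (op d')) (y : F'.obj d) :
    (TensorOver.mk ((underNerveModule k C).obj Δ) F (J.obj d)).compl₁₂
        (underNerveFreeMap J Δ d) (η.app d).hom (((underNerveModule k D).obj Δ).map f.op x) y =
      (TensorOver.mk ((underNerveModule k C).obj Δ) F (J.obj d')).compl₁₂
        (underNerveFreeMap J Δ d') (η.app d').hom x (F'.map f y) := by
  have h : (η.app d').hom (F'.map f y) = F.map (J.map f) ((η.app d).hom y) :=
    congrArg (fun l => l.hom y) (η.naturality f)
  rw [LinearMap.compl₁₂_apply, LinearMap.compl₁₂_apply, h, underNerveFreeMap_map]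
  exact TensorOver.mk_map (J.map f) _ _

/-- The map `[(f_n, …, f_0) ⊗ y] ↦ [(J f_n, …, J f_0) ⊗ η y]` induced by a functor `J : D ⥤ C` and a
natural transformation `η` from `F'` to the restriction of `F` along `J`. -/
def underNerveTensorMap : underNerveTensor F' ⟶ underNerveTensor F where
  app Δ := ModuleCat.ofHom <| TensorOver.desc (fun d =>
    (TensorOver.mk ((underNerveModule k C).obj Δ) F (J.obj d)).compl₁₂
      (underNerveFreeMap J Δ d) (η.app d).hom) (underNerveTensorMap_aux J η Δ)
  naturality Δ Δ' θ := by
    refine ModuleCat.hom_ext (TensorOver.hom_ext fun d x y => ?_)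
    refine (congrArg (TensorOver.desc _ (underNerveTensorMap_aux J η Δ'))
      (tensorMap_mk F' ((underNerveModule k D).map θ) d x y)).trans (Eq.symm ?_)
    refine (congrArg (tensorMap F ((underNerveModule k C).map θ))
      (TensorOver.desc_mk _ (underNerveTensorMap_aux J η Δ) d x y)).trans ?_
    refine (tensorMap_mk F ((underNerveModule k C).map θ) (J.obj d) _ _).trans (Eq.symm ?_)
    refine (TensorOver.desc_mk _ (underNerveTensorMap_aux J η Δ') d _ y).trans ?_
    rw [LinearMap.compl₁₂_apply, underNerveFreeMap_op]

lemma underNerveTensorMap_mk (Δ : SimplexCategoryᵒᵖ) (d : D)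
    (s : (nerve (Under d)).obj Δ) (y : F'.obj d) :
    ((underNerveTensorMap J η).app Δ).hom (underNerveMk F' Δ d s y) =
      underNerveMk F Δ (J.obj d) ((nerveMap (Under.post J)).app Δ s) ((η.app d).hom y) := by
  refine (TensorOver.desc_mk _ (underNerveTensorMap_aux J η Δ) d _ y).trans ?_
  refine congrArg (fun z => TensorOver.mk ((underNerveModule k C).obj Δ) F _ z _) ?_
  exact Finsupp.mapDomain_single

end ChangeOfCategory

end FunctorHomology

/-! ### The complexes -/

section Complexes

variable {k : Type u} {A : Type v} [CommRing k] [Ring A] [Algebra k A]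
  (α : AugmentedInvolution k A)

/-- The submodule of `k[N_n(- ↓ ΔH)] ⊗_{ΔH} H_A` generated by the classes
`[(f_n, …, f_1, f_0) ⊗ Y]` with `Y = a_0 ⊗ ⋯ ⊗ a_x` a basic tensor that has no trivial factor: all
`a_i` lie in the augmentation ideal. -/
def reducedSubmodule (Δ : SimplexCategoryᵒᵖ) :
    Submodule k ((underNerveTensor (barConstruction α.toInvolution)).obj Δ) :=
  Submodule.span k {t | ∃ (X : DeltaH) (s : (nerve (Under X)).obj Δ) (a : Fin (X.len + 1) → A),
    (∀ i, a i ∈ α.ideal) ∧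
      t = underNerveMk (barConstruction α.toInvolution) Δ X s (PiTensorProduct.tprod k a)}

lemma reducedSubmodule_map {Δ Δ' : SimplexCategoryᵒᵖ} (θ : Δ ⟶ Δ') :
    ∀ t ∈ reducedSubmodule α Δ,
      ((underNerveTensor (barConstruction α.toInvolution)).map θ).hom t ∈
        reducedSubmodule α Δ' := by
  change reducedSubmodule α Δ ≤ (reducedSubmodule α Δ').comap _
  refine Submodule.span_le.2 ?_
  rintro _ ⟨X, s, a, ha, rfl⟩
  refine Submodule.subset_span ⟨X, (nerve (Under X)).map θ s, a, ha, ?_⟩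
  exact underNerveTensor_map_mk _ θ X s _

/-- The submodules `reducedSubmodule α Δ`, as a simplicial submodule. -/
def reducedSimplicial : SimplicialObject (ModuleCat.{max u v} k) where
  obj Δ := ModuleCat.of k (reducedSubmodule α Δ)
  map θ := ModuleCat.ofHom <|
    ((underNerveTensor (barConstruction α.toInvolution)).map θ).hom.restrict
      (reducedSubmodule_map α θ)
  map_id Δ := by
    refine ModuleCat.hom_ext (LinearMap.ext fun t => Subtype.ext ?_)
    exact congrArg (fun l => l.hom t.1)
      ((underNerveTensor (barConstruction α.toInvolution)).map_id Δ)
  map_comp θ θ' := by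
    refine ModuleCat.hom_ext (LinearMap.ext fun t => Subtype.ext ?_)
    exact congrArg (fun l => l.hom t.1)
      ((underNerveTensor (barConstruction α.toInvolution)).map_comp θ θ')

/-- The chain complex of a simplicial module: the boundary map is the alternating sum of the face
maps. -/
abbrev toComplex (M : SimplicialObject (ModuleCat.{w} k)) : ChainComplex (ModuleCat.{w} k) ℕ :=
  (AlgebraicTopology.alternatingFaceMapComplex (ModuleCat.{w} k)).obj M

/-- The subcomplex `C_*(ΔH, I)` of `k[N_*(- ↓ ΔH)] ⊗_{ΔH} H_A`. -/
def reducedComplex : ChainComplex (ModuleCat.{max u v} k) ℕ := toComplex (reducedSimplicial α)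

/-- The reduced hyperoctahedral homology of `A`. -/
def reducedHO (n : ℕ) : ModuleCat.{max u v} k := (reducedComplex α).homology n

/-- The chain complex `k[N_*(- ↓ EpiΔH)] ⊗_{EpiΔH} H_I`. -/
def epiComplex : ChainComplex (ModuleCat.{max u v} k) ℕ :=
  toComplex (underNerveTensor (idealConstruction α))

/-- The chain complex `C_*(EpiΔH, H_I)`. -/
def epiGabrielZisman : ChainComplex (ModuleCat.{max u v} k) ℕ :=
  toComplex (gabrielZisman (idealConstruction α))

lemma epiInclusion_mem (Δ : SimplexCategoryᵒᵖ)
    (t : (underNerveTensor (idealConstruction α)).obj Δ) :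
    ((underNerveTensorMap epiInclusion (idealToBar α)).app Δ).hom t ∈ reducedSubmodule α Δ := by
  rw [← Submodule.Quotient.mk_eq_zero, ← Submodule.mkQ_apply]
  refine LinearMap.congr_fun (f := (reducedSubmodule α Δ).mkQ ∘ₗ
    ((underNerveTensorMap epiInclusion (idealToBar α)).app Δ).hom) (g := 0) ?_ t
  refine underNerveTensor_hom_ext fun X s y => ?_
  let L : (⨂[k] _ : Fin (X.obj.len + 1), α.ideal) →ₗ[k]
      (underNerveTensor (idealConstruction α)).obj Δ :=
    TensorOver.mk ((underNerveModule k EpiDeltaH).obj Δ) (idealConstruction α) X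
      (Finsupp.single s (1 : k))
  refine LinearMap.congr_fun (f := ((reducedSubmodule α Δ).mkQ ∘ₗ
    ((underNerveTensorMap epiInclusion (idealToBar α)).app Δ).hom) ∘ₗ L) (g := 0) ?_ y
  refine PiTensorProduct.ext (MultilinearMap.ext fun a => ?_)
  refine (Submodule.Quotient.mk_eq_zero _).2 ?_
  refine Submodule.subset_span ⟨X.obj, (nerveMap (Under.post epiInclusion)).app Δ s,
    fun i => a i, fun i => (a i).2, ?_⟩
  refine (underNerveTensorMap_mk epiInclusion (idealToBar α) Δ X s _).trans ?_
  refine congrArg (underNerveMk _ Δ X.obj _) ?_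
  exact PiTensorProduct.map_tprod _ _

/-- The inclusion `i_*` of `k[N_*(- ↓ EpiΔH)] ⊗_{EpiΔH} H_I` into `C_*(ΔH, I)`, given on classes by
`[(f_n, …, f_0) ⊗ Y] ↦ [(f_n, …, f_0) ⊗ Y]`. -/
def epiToReducedSimplicial : underNerveTensor (idealConstruction α) ⟶ reducedSimplicial α where
  app Δ := ModuleCat.ofHom <|
    ((underNerveTensorMap epiInclusion (idealToBar α)).app Δ).hom.codRestrict
      (reducedSubmodule α Δ) (epiInclusion_mem α Δ)
  naturality Δ Δ' θ := by
    refine ModuleCat.hom_ext (LinearMap.ext fun t => Subtype.ext ?_)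
    exact congrArg (fun l => l.hom t)
      ((underNerveTensorMap epiInclusion (idealToBar α)).naturality θ)

/-- The inclusion `i_*` as a map of chain complexes. -/
def epiToReduced : epiComplex α ⟶ reducedComplex α :=
  (AlgebraicTopology.alternatingFaceMapComplex (ModuleCat.{max u v} k)).map
    (epiToReducedSimplicial α)

end Complexes

end Hyperoctahedral

end

/-! Write $C_\star(\mathbf C,F)$ for the complex of strings with coefficients at the first object.
The argument identifies the reduced complex with such a complex over an auxiliary category of faces,
and then retracts that category onto $\mathrm{Epi}\Delta H$.

A face is an injective order-preserving map with trivial group element. Every morphism of $\Delta H$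
is uniquely an epimorphism followed by a face, with strict uniqueness because a face is determined
by its range. The category `FaceArrow` has the faces $[x]\to[n]$ as objects and, as morphisms, the
commutative squares whose left side is an epimorphism. Sending a face to $I^{\otimes x+1}$ is a
functor on it.

In $[(f_n,\dots,f_0)\otimes Y]$ with $Y$ a tensor of elements of $I$, factor $f_0=me$ with $e$ an
epimorphism and $m$ a face. The class equals $[(f_n,\dots,f_1,m)\otimes e_*Y]$, and $e_*Y$ is again
a tensor over $I$. Taking images of composites turns $(f_n,\dots,f_1)$ with $m$ into a string of
faces, so strings of faces generate the reduced complex (`faceToUnderNerve_range`). No relations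
remain: $A=k\oplus I$ splits $A^{\otimes n+1}$ into summands $I^{\otimes R}$ indexed by subsets $R$,
distinct faces hit distinct summands, and a string of faces is determined by its targets and its
first face (`mapFunctor_faceToBar_injective`, `FaceArrow.string_ext`).

The source functor to $\mathrm{Epi}\Delta H$ has the inclusion of identity faces as a strict
section. The squares from $\mathrm{id}_{[x]}$ to $m\colon[x]\to[n]$ form a natural transformation
from the other composite to the identity, and they act trivially on coefficients. Hence the two
complexes of strings are homotopy equivalent (`gabrielZismanHomotopy`, `faceHomotopy`). The
isomorphism $k[N_\star(-\downarrow\mathbf C)]\otimes_{\mathbf C}F\cong C_\star(\mathbf C,F)$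
(`underNerveTensorIso`) returns to the complexes of the theorem, and `epiToReducedSimplicial_eq`
shows that the resulting equivalence is $i_\star$ itself. -/

noncomputable section

namespace Hyperoctahedral

universe u v w

/-! ### Simplicial homotopies from families indexed by the simplices of $\Delta[1]$. -/

open Simplicial in
/-- The order-preserving map `⦋n + 1⦌ ⟶ ⦋1⦌` whose fibre over `0` is `{0, …, i}`. -/
def cutAfter {n : ℕ} (i : Fin (n + 1)) : ⦋n + 1⦌ ⟶ ⦋1⦌ :=
  SimplexCategory.Hom.mk
    { toFun := fun l => if i.castSucc < l then 1 else 0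
      monotone' := fun a b hab => by
        dsimp only
        split_ifs with h1 h2
        · exact le_rfl
        · exact absurd (h1.trans_le hab) h2
        · exact zero_le_one
        · exact le_rfl }

lemma cutAfter_apply {n : ℕ} (i : Fin (n + 1)) (l : Fin (n + 2)) :
    cutAfter i l = if i.castSucc < l then 1 else 0 := rfl

open Simplicial in
/-- The constant map `Δ ⟶ ⦋1⦌` with value `a`. -/
def constOne (Δ : SimplexCategory) (a : Fin 2) : Δ ⟶ ⦋1⦌ :=
  SimplexCategory.Hom.mk ⟨fun _ => a, fun _ _ _ => le_rfl⟩

open Simplicial in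
/-- A family of maps `X ⟶ Y`, indexed naturally by the simplices of `Δ[1]`, is a simplicial homotopy
between its restrictions to the two vertices. -/
def homotopyOfCylinder {V : Type u} [Category.{v} V] {X Y : SimplicialObject V} {f g : X ⟶ Y}
    (H : ∀ Δ : SimplexCategoryᵒᵖ, (Δ.unop ⟶ ⦋1⦌) → (X.obj Δ ⟶ Y.obj Δ))
    (hH : ∀ {Δ Δ' : SimplexCategoryᵒᵖ} (θ : Δ ⟶ Δ') (χ : Δ.unop ⟶ ⦋1⦌),
      H Δ χ ≫ Y.map θ = X.map θ ≫ H Δ' (θ.unop ≫ χ))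
    (h0 : ∀ Δ, H Δ (constOne Δ.unop 0) = f.app Δ)
    (h1 : ∀ Δ, H Δ (constOne Δ.unop 1) = g.app Δ) : SimplicialObject.Homotopy f g := by
  have key : ∀ {n m : ℕ} (σ : op ⦋n⦌ ⟶ op ⦋m⦌) (χ : ⦋n⦌ ⟶ ⦋1⦌) (χ' : ⦋m⦌ ⟶ ⦋1⦌),
      (∀ l, χ (σ.unop l) = χ' l) → H (op ⦋n⦌) χ ≫ Y.map σ = X.map σ ≫ H (op ⦋m⦌) χ' := by
    intro n m σ χ χ' h
    rw [hH]
    congr 2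
    ext l : 3
    exact h l
  have hδ : ∀ {n : ℕ} (i : Fin (n + 2)) (χ : ⦋n + 1⦌ ⟶ ⦋1⦌) (χ' : ⦋n⦌ ⟶ ⦋1⦌),
      (∀ l, χ (i.succAbove l) = χ' l) → H _ χ ≫ Y.δ i = X.δ i ≫ H _ χ' :=
    fun i χ χ' h => key _ χ χ' h
  have hσ : ∀ {n : ℕ} (i : Fin (n + 1)) (χ : ⦋n⦌ ⟶ ⦋1⦌) (χ' : ⦋n + 1⦌ ⟶ ⦋1⦌),
      (∀ l, χ (i.predAbove l) = χ' l) → H _ χ ≫ Y.σ i = X.σ i ≫ H _ χ' :=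
    fun i χ χ' h => key _ χ χ' h
  refine
  -- The prism decomposition: the nondegenerate $(n+1)$-simplices of $\Delta[n]\times\Delta[1]$ of
  -- top dimension are the pairs of $\sigma_i$ and `cutAfter i`. The zeroth face of $h_0$ leaves
  -- only the value 1, hence `g`; the last face of the last $h_i$ leaves only the value 0, hence
  -- `f`.
  { h := fun i => X.σ i ≫ H _ (cutAfter i)
    h_zero_comp_δ_zero := fun n => ?_
    h_last_comp_δ_last := fun n => ?_
    h_succ_comp_δ_castSucc_of_lt := fun {n} i j hij => ?_
    h_succ_comp_δ_castSucc_succ := fun {n} j => ?_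
    h_castSucc_comp_δ_succ_of_lt := fun {n} i j hji => ?_
    h_comp_σ_castSucc_of_le := fun {n} i j hij => ?_
    h_comp_σ_succ_of_lt := fun {n} i j hji => ?_ }
  · rw [Category.assoc, hδ _ _ (constOne _ 1), ← h1, ← Category.assoc]
    · exact (congrArg (· ≫ _) (X.δ_comp_σ_self' rfl)).trans (Category.id_comp _)
    · intro l
      refine (cutAfter_apply _ _).trans (if_pos ?_)
      simp [Fin.lt_def]
  · rw [Category.assoc, hδ _ _ (constOne _ 0), ← h0, ← Category.assoc]
    · exact (congrArg (· ≫ _) (X.δ_comp_σ_succ' rfl)).trans (Category.id_comp _)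
    · intro l
      refine (cutAfter_apply _ _).trans (if_neg ?_)
      simpa [Fin.lt_def] using l.is_le
  · rw [Category.assoc, hδ _ _ (cutAfter j), ← Category.assoc, X.δ_comp_σ_of_le hij, Category.assoc]
    intro l
    simp only [cutAfter_apply, Fin.succAbove, Fin.lt_def, Fin.le_def] at hij ⊢
    grind
  -- Adjacent prisms share a face: the cuts after $j$ and after $j+1$ differ only at the point
  -- $j+1$, which this coface omits.
  · let χ : ⦋n + 1⦌ ⟶ ⦋1⦌ := SimplexCategory.δ j.castSucc.succ ≫ cutAfter j.castSucc
    rw [Category.assoc, Category.assoc, hδ _ (cutAfter j.succ) χ, hδ _ (cutAfter j.castSucc) χ,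
      ← Category.assoc, ← Category.assoc, X.δ_comp_σ_self' (Fin.succ_castSucc j), X.δ_comp_σ_succ]
    · exact fun _ => rfl
    · intro l
      change _ = cutAfter j.castSucc (j.castSucc.succ.succAbove l)
      simp only [cutAfter_apply, Fin.succAbove, Fin.lt_def]
      grind
  · rw [Category.assoc, hδ _ _ (cutAfter j), ← Category.assoc, X.δ_comp_σ_of_gt hji, Category.assoc]
    intro l
    simp only [cutAfter_apply, Fin.succAbove, Fin.lt_def] at hji ⊢
    grind
  · rw [Category.assoc, hσ _ _ (cutAfter j.succ), ← Category.assoc, X.σ_comp_σ hij, Category.assoc]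
    intro l
    refine if_congr ?_ rfl rfl
    simp only [Fin.predAbove, Fin.lt_def, Fin.le_def] at hij ⊢
    split_ifs with h <;>
      simp only [Fin.val_castSucc, Fin.val_succ, Fin.val_pred, Fin.coe_castPred] at h ⊢ <;> omega
  · rw [Category.assoc, hσ _ _ (cutAfter j.castSucc), ← Category.assoc, ← X.σ_comp_σ hji,
      Category.assoc]
    intro l
    refine if_congr ?_ rfl rfl
    simp only [Fin.predAbove, Fin.lt_def, Fin.le_def] at hji ⊢
    split_ifs with h <;>
      simp only [Fin.val_castSucc, Fin.val_succ, Fin.val_pred, Fin.coe_castPred] at h ⊢ <;> omega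

/-! ### Functoriality of $C_\star(\mathbf C,F)$, and homotopies from natural transformations. -/

section GabrielZisman

variable {k : Type u} [CommRing k] {C D : Type} [SmallCategory C] [SmallCategory D]

namespace GZ

/-- The coefficients are compared by `HEq` because they lie in summands indexed by strings that need
not be definitionally equal. -/
lemma mk_congr (F : C ⥤ ModuleCat.{w} k) (Δ : SimplexCategoryᵒᵖ)
    {s s' : ComposableArrows C Δ.unop.len} (h : s = s') {y : F.obj s.left} {y' : F.obj s'.left}
    (hy : HEq y y') : mk F Δ s y = mk F Δ s' y' := by
  subst h
  rw [eq_of_heq hy]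

open Classical in
/-- The map `⨁ F(C_0) ⟶ ⨁ F'(D_0)` given by a map of the index sets and by a linear map for every
string. -/
def lift {F : C ⥤ ModuleCat.{w} k} {F' : D ⥤ ModuleCat.{w} k} {Δ Δ' : SimplexCategoryᵒᵖ}
    (p : ComposableArrows C Δ.unop.len → ComposableArrows D Δ'.unop.len)
    (l : ∀ s : ComposableArrows C Δ.unop.len, F.obj s.left →ₗ[k] F'.obj (p s).left) :
    GZ F Δ →ₗ[k] GZ F' Δ' :=
  DirectSum.toModule k _ _ fun s => mk F' Δ' (p s) ∘ₗ l s

lemma lift_mk {F : C ⥤ ModuleCat.{w} k} {F' : D ⥤ ModuleCat.{w} k} {Δ Δ' : SimplexCategoryᵒᵖ}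
    (p : ComposableArrows C Δ.unop.len → ComposableArrows D Δ'.unop.len)
    (l : ∀ s : ComposableArrows C Δ.unop.len, F.obj s.left →ₗ[k] F'.obj (p s).left)
    (s : ComposableArrows C Δ.unop.len) (y : F.obj s.left) :
    lift p l (mk F Δ s y) = mk F' Δ' (p s) (l s y) := by
  classical
  rw [lift, mk, DirectSum.toModule_lof]
  rfl

/-- The component of an element of `⨁ F(C_0)` at the string `s`. -/
def component (F : C ⥤ ModuleCat.{w} k) (Δ : SimplexCategoryᵒᵖ)
    (s : ComposableArrows C Δ.unop.len) : GZ F Δ →ₗ[k] F.obj s.left :=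
  DirectSum.component k (ComposableArrows C Δ.unop.len) (fun s => F.obj s.left) s

lemma component_mk_self (F : C ⥤ ModuleCat.{w} k) (Δ : SimplexCategoryᵒᵖ)
    (s : ComposableArrows C Δ.unop.len) (y : F.obj s.left) : component F Δ s (mk F Δ s y) = y := by
  classical
  exact DirectSum.component.lof_self (M := fun s : ComposableArrows C Δ.unop.len => F.obj s.left)
    k s y

lemma component_mk_of_ne (F : C ⥤ ModuleCat.{w} k) (Δ : SimplexCategoryᵒᵖ)
    {s s' : ComposableArrows C Δ.unop.len} (h : s' ≠ s) (y : F.obj s'.left) :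
    component F Δ s (mk F Δ s' y) = 0 := by
  classical
  exact (DirectSum.component.of (M := fun s : ComposableArrows C Δ.unop.len => F.obj s.left)
    k s s' y).trans (dif_neg h)

end GZ

variable {F : C ⥤ ModuleCat.{w} k} {F' : D ⥤ ModuleCat.{w} k}

/-- The map `(s, y) ↦ (P s, η y)`, in one degree. -/
def GZ.mapFunctor (P : C ⥤ D) (η : F ⟶ P ⋙ F') (Δ : SimplexCategoryᵒᵖ) : GZ F Δ →ₗ[k] GZ F' Δ :=
  GZ.lift (Δ := Δ) (Δ' := Δ) (fun s => s ⋙ P) (fun s => (η.app s.left).hom)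

lemma GZ.mapFunctor_mk (P : C ⥤ D) (η : F ⟶ P ⋙ F') (Δ : SimplexCategoryᵒᵖ)
    (s : ComposableArrows C Δ.unop.len) (y : F.obj s.left) :
    GZ.mapFunctor P η Δ (GZ.mk F Δ s y) = GZ.mk F' Δ (s ⋙ P) ((η.app s.left).hom y) :=
  GZ.lift_mk (Δ := Δ) (Δ' := Δ) _ _ s y

/-- The map `(s, y) ↦ (P s, η y)` induced by a functor `P` and a natural transformation `η` from `F`
to the restriction of `F'` along `P`. -/
def gabrielZismanMap (P : C ⥤ D) (η : F ⟶ P ⋙ F') : gabrielZisman F ⟶ gabrielZisman F' where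
  app Δ := ModuleCat.ofHom (GZ.mapFunctor P η Δ)
  naturality Δ Δ' θ := by
    refine ModuleCat.hom_ext (GZ.hom_ext fun s y => ?_)
    refine (congrArg (GZ.mapFunctor P η Δ') (GZ.map_mk F θ s y)).trans
      ((GZ.mapFunctor_mk P η Δ' _ _).trans (Eq.symm ?_))
    refine (congrArg (GZ.map F' θ) (GZ.mapFunctor_mk P η Δ s y)).trans
      ((GZ.map_mk F' θ _ _).trans ?_)
    refine congrArg (GZ.mk F' Δ' _) ?_
    exact (congrArg (fun l => l.hom y)
      (η.naturality (s.map (homOfLE (Fin.zero_le (θ.unop.toOrderHom 0)))))).symm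

lemma gabrielZisman_hom_ext {X : SimplicialObject (ModuleCat.{w} k)} {f g : gabrielZisman F ⟶ X}
    (h : ∀ Δ s y, (f.app Δ).hom (GZ.mk F Δ s y) = (g.app Δ).hom (GZ.mk F Δ s y)) : f = g :=
  NatTrans.ext (funext fun Δ => ModuleCat.hom_ext (GZ.hom_ext (h Δ)))

/-- The transformation `θ` only has to agree pointwise with the composite of `η` and `η'`, so that a
family of identities may be supplied for it. -/
lemma gabrielZismanMap_comp {E : Type} [SmallCategory E] {F'' : E ⥤ ModuleCat.{w} k} (P : C ⥤ D)
    (η : F ⟶ P ⋙ F') (Q : D ⥤ E) (η' : F' ⟶ Q ⋙ F'') (θ : F ⟶ (P ⋙ Q) ⋙ F'')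
    (h : ∀ c, θ.app c = η.app c ≫ η'.app (P.obj c)) :
    gabrielZismanMap P η ≫ gabrielZismanMap Q η' = gabrielZismanMap (P ⋙ Q) θ :=
  gabrielZisman_hom_ext fun Δ s y => by
    refine (congrArg (GZ.mapFunctor Q η' Δ) (GZ.mapFunctor_mk P η Δ s y)).trans ?_
    refine (GZ.mapFunctor_mk Q η' Δ _ _).trans (Eq.trans ?_ (GZ.mapFunctor_mk _ θ Δ s y).symm)
    exact congrArg (GZ.mk F'' Δ (s ⋙ P ⋙ Q)) (congrArg (fun l => l.hom y) (h s.left)).symm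

lemma gabrielZismanMap_id (η : F ⟶ 𝟭 C ⋙ F) (h : ∀ c, η.app c = 𝟙 (F.obj c)) :
    gabrielZismanMap (𝟭 C) η = 𝟙 (gabrielZisman F) :=
  gabrielZisman_hom_ext fun Δ s y => (GZ.mapFunctor_mk _ η Δ s y).trans
    (congrArg (GZ.mk F Δ s) (congrArg (fun l => l.hom y) (h s.left)))

section Cylinder

variable {P Q : C ⥤ D} (τ : P ⟶ Q)

/-- The natural transformation `τ`, as a functor from `C × {0 < 1}`. -/
def cylinderFunctor : Fin 2 × C ⥤ D := Functor.uncurry.obj (ComposableArrows.mk₁ τ)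

open Simplicial in
/-- The string `P C_0 → ⋯ → P C_i → Q C_{i + 1} → ⋯ → Q C_n`, where `i` is the last point at which
`χ` is `0`. -/
def cylinderString {n : SimplexCategory} (χ : n ⟶ ⦋1⦌) (s : ComposableArrows C n.len) :
    ComposableArrows D n.len :=
  Functor.prod' χ.toOrderHom.monotone.functor s ⋙ cylinderFunctor τ

lemma cylinderFunctor_map_zero {X Y : C} (f : X ⟶ Y) :
    (cylinderFunctor τ).map (X := ((0 : Fin 2), X)) (Y := ((0 : Fin 2), Y)) (𝟙 0, f) = P.map f := by
  change ((ComposableArrows.mk₁ τ).map (𝟙 0)).app X ≫ P.map f = P.map f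
  rw [CategoryTheory.Functor.map_id]
  exact Category.id_comp _

lemma cylinderFunctor_map_one {X Y : C} (f : X ⟶ Y) :
    (cylinderFunctor τ).map (X := ((1 : Fin 2), X)) (Y := ((1 : Fin 2), Y)) (𝟙 1, f) = Q.map f := by
  change ((ComposableArrows.mk₁ τ).map (𝟙 1)).app X ≫ Q.map f = Q.map f
  rw [CategoryTheory.Functor.map_id]
  exact Category.id_comp _

lemma cylinderFunctor_map_arrow (X : C) :
    (cylinderFunctor τ).map (X := ((0 : Fin 2), X)) (Y := ((1 : Fin 2), X))
      (homOfLE (Fin.zero_le _), 𝟙 X) = τ.app X := by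
  change τ.app X ≫ Q.map (𝟙 X) = τ.app X
  rw [Q.map_id]
  exact Category.comp_id _

lemma cylinderString_zero {n : SimplexCategory} (s : ComposableArrows C n.len) :
    cylinderString τ (constOne n 0) s = s ⋙ P :=
  CategoryTheory.Functor.ext (fun _ => rfl) fun _ _ f =>
    (cylinderFunctor_map_zero τ (s.map f)).trans
      ((Category.id_comp _).trans (Category.comp_id _)).symm

lemma cylinderString_one {n : SimplexCategory} (s : ComposableArrows C n.len) :
    cylinderString τ (constOne n 1) s = s ⋙ Q :=
  CategoryTheory.Functor.ext (fun _ => rfl) fun _ _ f =>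
    (cylinderFunctor_map_one τ (s.map f)).trans
      ((Category.id_comp _).trans (Category.comp_id _)).symm

open Simplicial in
/-- The map `(s, y) ↦ (cylinderString τ χ s, η y)`, followed by the action of `τ` on `η y` if the
first object of the new string is in the image of `Q`. -/
def GZ.cylinderMap (η : F ⟶ P ⋙ F') (Δ : SimplexCategoryᵒᵖ) (χ : Δ.unop ⟶ ⦋1⦌) :
    GZ F Δ →ₗ[k] GZ F' Δ :=
  GZ.lift (Δ := Δ) (Δ' := Δ) (cylinderString τ χ) fun s =>
    (η.app s.left ≫ F'.map ((cylinderFunctor τ).map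
      (X := ((0 : Fin 2), s.left)) (Y := (χ.toOrderHom 0, s.left))
      (homOfLE (Fin.zero_le _), 𝟙 s.left))).hom

open Simplicial in
lemma GZ.cylinderMap_mk (η : F ⟶ P ⋙ F') (Δ : SimplexCategoryᵒᵖ) (χ : Δ.unop ⟶ ⦋1⦌)
    (s : ComposableArrows C Δ.unop.len) (y : F.obj s.left) :
    GZ.cylinderMap τ η Δ χ (GZ.mk F Δ s y) = GZ.mk F' Δ (cylinderString τ χ s)
      ((η.app s.left ≫ F'.map ((cylinderFunctor τ).map
        (X := ((0 : Fin 2), s.left)) (Y := (χ.toOrderHom 0, s.left))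
        (homOfLE (Fin.zero_le _), 𝟙 s.left))).hom y) :=
  GZ.lift_mk (Δ := Δ) (Δ' := Δ) _ _ s y

/-- The diagram chase of `GZ.map_cylinderMap`: `h` is there the naturality of `η`, and `h'` compares
two paths in the image of the cylinder on `C`. -/
lemma comp_map_eq_of_eq {V : Type*} [Category* V] (G : D ⥤ V) {U U' : V} {X Y Z W : D} {a : U ⟶ U'}
    {b : U' ⟶ G.obj Y} {c : U ⟶ G.obj X} {p : X ⟶ Y} {q : Y ⟶ Z} {r : X ⟶ W} {t : W ⟶ Z}
    (h : a ≫ b = c ≫ G.map p) (h' : p ≫ q = r ≫ t) :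
    a ≫ b ≫ G.map q = (c ≫ G.map r) ≫ G.map t := by
  rw [← Category.assoc, h, Category.assoc, Category.assoc, ← G.map_comp, ← G.map_comp, h']

-- Both sides land in the summand of the same string, so only the coefficients matter. These are
-- moved from $(0,C_0)$ to $(\chi(\theta 0),C_{\theta 0})$ along two paths in $\{0<1\}\times\mathbf
-- C$, first in the direction of `C` or first in that of $\{0<1\}$. The paths agree because
-- $\{0<1\}$ is a poset.
open Simplicial in
lemma GZ.map_cylinderMap (η : F ⟶ P ⋙ F') {Δ Δ' : SimplexCategoryᵒᵖ} (θ : Δ ⟶ Δ')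
    (χ : Δ.unop ⟶ ⦋1⦌) :
    GZ.map F' θ ∘ₗ GZ.cylinderMap τ η Δ χ =
      GZ.cylinderMap τ η Δ' (θ.unop ≫ χ) ∘ₗ GZ.map F θ := by
  refine GZ.hom_ext fun s y => ?_
  refine (congrArg (GZ.map F' θ) (GZ.cylinderMap_mk τ η Δ χ s y)).trans
    ((GZ.map_mk F' θ _ _).trans (Eq.symm ?_))
  refine (congrArg (GZ.cylinderMap τ η Δ' (θ.unop ≫ χ)) (GZ.map_mk F θ s y)).trans
    ((GZ.cylinderMap_mk τ η Δ' _ _ _).trans ?_)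
  refine congrArg (GZ.mk F' Δ' (cylinderString τ (θ.unop ≫ χ) ((nerve C).map θ s))) ?_
  let a := θ.unop.toOrderHom 0
  let f : s.left ⟶ s.obj a := s.map (homOfLE (Fin.zero_le a))
  have hη : F.map f ≫ η.app (s.obj a) = η.app s.left ≫ F'.map ((cylinderFunctor τ).map
      (X := ((0 : Fin 2), s.left)) (Y := ((0 : Fin 2), s.obj a)) (𝟙 0, f)) := by
    rw [cylinderFunctor_map_zero]
    exact η.naturality f
  have hτ : (cylinderFunctor τ).map (X := ((0 : Fin 2), s.left)) (Y := ((0 : Fin 2), s.obj a))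
        (𝟙 0, f) ≫ (cylinderFunctor τ).map (X := ((0 : Fin 2), s.obj a))
        (Y := (χ.toOrderHom a, s.obj a)) (homOfLE (Fin.zero_le _), 𝟙 (s.obj a)) =
      (cylinderFunctor τ).map (X := ((0 : Fin 2), s.left)) (Y := (χ.toOrderHom 0, s.left))
        (homOfLE (Fin.zero_le _), 𝟙 s.left) ≫
          (cylinderString τ χ s).map (homOfLE (Fin.zero_le a)) := by
    refine ((cylinderFunctor τ).map_comp _ _).symm.trans
      (Eq.trans ?_ ((cylinderFunctor τ).map_comp _ _))
    refine congrArg _ (Prod.ext (Subsingleton.elim _ _) ?_)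
    exact (Category.comp_id f).trans (Category.id_comp f).symm
  exact congrArg (fun l => l.hom y) (comp_map_eq_of_eq F' hη hτ)

/-- A natural transformation `τ : P ⟶ Q` with `F' τ ∘ η = η'` gives a simplicial homotopy between
the maps induced by `(P, η)` and by `(Q, η')`. -/
def gabrielZismanHomotopy (η : F ⟶ P ⋙ F') (η' : F ⟶ Q ⋙ F')
    (h : ∀ c, η.app c ≫ F'.map (τ.app c) = η'.app c) :
    SimplicialObject.Homotopy (gabrielZismanMap P η) (gabrielZismanMap Q η') :=
  homotopyOfCylinder (fun Δ χ => ModuleCat.ofHom (GZ.cylinderMap τ η Δ χ))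
    (fun θ χ => ModuleCat.hom_ext (GZ.map_cylinderMap τ η θ χ))
    (fun Δ => by
      refine ModuleCat.hom_ext (GZ.hom_ext fun s y => ?_)
      refine (GZ.cylinderMap_mk τ η Δ _ s y).trans (Eq.trans ?_ (GZ.mapFunctor_mk P η Δ s y).symm)
      refine GZ.mk_congr F' Δ (cylinderString_zero τ s) (heq_of_eq ?_)
      refine congrArg (fun l => l.hom y)
        (?_ : η.app s.left ≫ F'.map ((cylinderFunctor τ).map (X := ((0 : Fin 2), s.left))
          (Y := ((0 : Fin 2), s.left)) (𝟙 0, 𝟙 s.left)) = η.app s.left)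
      rw [cylinderFunctor_map_zero, P.map_id]
      exact (congrArg _ (F'.map_id _)).trans (Category.comp_id _))
    (fun Δ => by
      refine ModuleCat.hom_ext (GZ.hom_ext fun s y => ?_)
      refine (GZ.cylinderMap_mk τ η Δ _ s y).trans (Eq.trans ?_ (GZ.mapFunctor_mk Q η' Δ s y).symm)
      refine GZ.mk_congr F' Δ (cylinderString_one τ s) (heq_of_eq ?_)
      refine congrArg (fun l => l.hom y) (Eq.trans ?_ (h s.left))
      exact congrArg (fun l => η.app s.left ≫ F'.map l) (cylinderFunctor_map_arrow τ s.left))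

end Cylinder

end GabrielZisman

/-! ### The isomorphism $k[N_\star(-\downarrow\mathbf C)]\otimes_{\mathbf C}F\cong C_\star(\mathbf
C,F)$. -/

section Comparison

variable {k : Type u} [CommRing k] {C : Type} [SmallCategory C]

/-- The string `C_0 → ⋯ → C_n`, as a string under `c` by means of an arrow `c ⟶ C_0`. -/
def underString {n : ℕ} (s : ComposableArrows C n) {c : C} (f : c ⟶ s.left) :
    ComposableArrows (Under c) n where
  obj i := Under.mk (f ≫ s.map (homOfLE (Fin.zero_le i)))
  map {i j} g := Under.homMk (s.map g) (by
    change (f ≫ _) ≫ s.map g = f ≫ _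
    rw [Category.assoc, ← s.map_comp]
    rfl)
  map_id i := Under.UnderMorphism.ext (s.map_id i)
  map_comp g h := Under.UnderMorphism.ext (s.map_comp g h)

/-- In a string under `c`, commutativity of the triangles forces every structure arrow $c\to C_i$ to
be $c\to C_0$ followed by the arrow $C_0\to C_i$ of the string. -/
lemma underString_forget {n : ℕ} {c : C} (t : ComposableArrows (Under c) n) :
    underString (c := c) (t ⋙ Under.forget c) t.left.hom = t := by
  have h : ∀ i, (underString (c := c) (t ⋙ Under.forget c) t.left.hom).obj i = t.obj i :=
    fun i => congrArg Under.mk (Under.w (t.map (homOfLE (Fin.zero_le i))))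
  refine CategoryTheory.Functor.ext h fun i j g => Under.UnderMorphism.ext ?_
  rw [Under.comp_right, Under.comp_right, under_eqToHom_right, under_eqToHom_right]
  exact ((Category.id_comp _).trans (Category.comp_id _)).symm

lemma underString_eq {n : ℕ} {c : C} (t : ComposableArrows (Under c) n) {s : ComposableArrows C n}
    {f : c ⟶ s.left} (h : s = t ⋙ Under.forget c) (hf : HEq f t.left.hom) :
    underString s f = t := by
  subst h
  rw [eq_of_heq hf]
  exact underString_forget t

lemma underString_comp {n : ℕ} (s : ComposableArrows C n) {c c' : C} (g : c ⟶ c')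
    (f : c' ⟶ s.left) : underString s (g ≫ f) = underString s f ⋙ Under.map g := by
  have h : ∀ i, (underString s (g ≫ f)).obj i = (underString s f ⋙ Under.map g).obj i :=
    fun i => congrArg Under.mk (Category.assoc g f _)
  refine CategoryTheory.Functor.ext h fun i j e => Under.UnderMorphism.ext ?_
  rw [Under.comp_right, Under.comp_right, under_eqToHom_right, under_eqToHom_right]
  exact ((Category.id_comp _).trans (Category.comp_id _)).symm

variable (F : C ⥤ ModuleCat.{max u v} k)

/-- `[g^* s ⊗ y] = [s ⊗ F(g) y]`. -/
lemma underNerveMk_map (Δ : SimplexCategoryᵒᵖ) {c c' : C} (g : c ⟶ c')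
    (s : ComposableArrows (Under c') Δ.unop.len) (y : F.obj c) :
    underNerveMk F Δ c (s ⋙ Under.map g) y = underNerveMk F Δ c' s ((F.map g).hom y) := by
  refine Eq.trans ?_ (TensorOver.mk_map (G := (underNerveModule k C).obj Δ) (F := F) g
    (Finsupp.single s (1 : k)) y)
  refine congrArg (fun z : ((underNerveModule k C).obj Δ).obj (op c) =>
    TensorOver.mk ((underNerveModule k C).obj Δ) F c z y) ?_
  exact (Finsupp.mapDomain_single (a := s) (b := (1 : k))
    (f := fun t : ComposableArrows (Under c') Δ.unop.len => t ⋙ Under.map g)).symm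

/-- The map `(f_n, …, f_1, f_0) ↦ (y ↦ ((f_n, …, f_1), F(f_0) y))`. -/
def underNerveToGZAux (Δ : SimplexCategoryᵒᵖ) (c : C) :
    ((underNerveModule k C).obj Δ).obj (op c) →ₗ[k] F.obj c →ₗ[k] GZ F Δ :=
  Finsupp.lift (F.obj c →ₗ[k] GZ F Δ) k (ComposableArrows (Under c) Δ.unop.len) fun t =>
    GZ.mk F Δ (t ⋙ Under.forget c) ∘ₗ (F.map t.left.hom).hom

lemma underNerveToGZAux_single (Δ : SimplexCategoryᵒᵖ) (c : C)
    (t : ComposableArrows (Under c) Δ.unop.len) (y : F.obj c) :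
    underNerveToGZAux F Δ c (Finsupp.single t (1 : k)) y =
      GZ.mk F Δ (t ⋙ Under.forget c) ((F.map t.left.hom).hom y) := by
  exact congrArg (fun l : F.obj c →ₗ[k] GZ F Δ => l y) ((Finsupp.lift_apply _ _ _ _ _).trans
    ((Finsupp.sum_single_index (a := t) (b := (1 : k))
      (h := fun t r => r • (GZ.mk F Δ (t ⋙ Under.forget c) ∘ₗ (F.map t.left.hom).hom))
      (zero_smul _ _)).trans (one_smul _ _)))

/-- On a basis element, replacing $f_0$ by $f_0f$ leaves $(f_n,\dots,f_1)$ alone, and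
$F(f_0f)=F(f_0)F(f)$. This is the compatibility needed to descend to the tensor product over `C`. -/
lemma underNerveToGZAux_map (Δ : SimplexCategoryᵒᵖ) {c c' : C} (f : c ⟶ c')
    (x : ((underNerveModule k C).obj Δ).obj (op c')) (y : F.obj c) :
    underNerveToGZAux F Δ c (((underNerveModule k C).obj Δ).map f.op x) y =
      underNerveToGZAux F Δ c' x (F.map f y) := by
  let L : ((underNerveModule k C).obj Δ).obj (op c') →ₗ[k] GZ F Δ :=
    (underNerveToGZAux F Δ c).flip y ∘ₗ (((underNerveModule k C).obj Δ).map f.op).hom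
  let L' : ((underNerveModule k C).obj Δ).obj (op c') →ₗ[k] GZ F Δ :=
    (underNerveToGZAux F Δ c').flip (F.map f y)
  have h : L = L' := Finsupp.lhom_ext' fun t => LinearMap.ext_ring (by
    let t' : ComposableArrows (Under c') Δ.unop.len := t
    refine (congrArg (fun z : ((underNerveModule k C).obj Δ).obj (op c) =>
      underNerveToGZAux F Δ c z y) (Finsupp.mapDomain_single (a := t))).trans ?_
    refine (underNerveToGZAux_single F Δ c (t' ⋙ Under.map f) y).trans
      (Eq.trans ?_ (underNerveToGZAux_single F Δ c' t' _).symm)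
    refine congrArg (GZ.mk F Δ (t' ⋙ Under.forget c')) ?_
    exact congrArg (fun l => l.hom y) (F.map_comp f t'.left.hom))
  exact congrArg (fun l => l x) h

/-- The map `[(f_n, …, f_1, f_0) ⊗ y] ↦ ((f_n, …, f_1), F(f_0) y)`, in one degree. -/
def underNerveToGZ (Δ : SimplexCategoryᵒᵖ) : (underNerveTensor F).obj Δ →ₗ[k] GZ F Δ :=
  TensorOver.desc (underNerveToGZAux F Δ) (underNerveToGZAux_map F Δ)

lemma underNerveToGZ_mk (Δ : SimplexCategoryᵒᵖ) (c : C)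
    (t : ComposableArrows (Under c) Δ.unop.len) (y : F.obj c) :
    underNerveToGZ F Δ (underNerveMk F Δ c t y) =
      GZ.mk F Δ (t ⋙ Under.forget c) ((F.map t.left.hom).hom y) :=
  (TensorOver.desc_mk _ (underNerveToGZAux_map F Δ) c _ y).trans
    (underNerveToGZAux_single F Δ c t y)

/-- The map `((f_n, …, f_1), y) ↦ [(f_n, …, f_1, id) ⊗ y]`, in one degree. -/
def gzToUnderNerve (Δ : SimplexCategoryᵒᵖ) : GZ F Δ →ₗ[k] (underNerveTensor F).obj Δ := by
  classical
  exact DirectSum.toModule k _ _ fun s =>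
    TensorOver.mk ((underNerveModule k C).obj Δ) F s.left
      (Finsupp.single (underString s (𝟙 s.left)) (1 : k))

lemma gzToUnderNerve_mk (Δ : SimplexCategoryᵒᵖ) (s : ComposableArrows C Δ.unop.len)
    (y : F.obj s.left) : gzToUnderNerve F Δ (GZ.mk F Δ s y) =
      underNerveMk F Δ s.left (underString s (𝟙 s.left)) y := by
  classical
  exact DirectSum.toModule_lof (M := fun s : ComposableArrows C Δ.unop.len => F.obj s.left) k s y

lemma underNerveToGZ_gzToUnderNerve (Δ : SimplexCategoryᵒᵖ) :
    underNerveToGZ F Δ ∘ₗ gzToUnderNerve F Δ = LinearMap.id := by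
  refine GZ.hom_ext fun s y => ?_
  refine (congrArg (underNerveToGZ F Δ) (gzToUnderNerve_mk F Δ s y)).trans
    ((underNerveToGZ_mk F Δ _ _ _).trans ?_)
  refine congrArg (GZ.mk F Δ s) ?_
  have h : 𝟙 s.left ≫ s.map (𝟙 0) = 𝟙 s.left :=
    (Category.id_comp _).trans (s.map_id _)
  exact congrArg (fun l => l.hom y) ((congrArg F.map h).trans (F.map_id _))

/-- The co-Yoneda argument: a string $(f_n,\dots,f_0)$ is the pullback along $f_0$ of
$(f_n,\dots,f_1,\mathrm{id})$, so the tensor relation moves $f_0$ onto the coefficient. -/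
lemma gzToUnderNerve_underNerveToGZ (Δ : SimplexCategoryᵒᵖ) :
    gzToUnderNerve F Δ ∘ₗ underNerveToGZ F Δ = LinearMap.id := by
  refine underNerveTensor_hom_ext fun c t y => ?_
  let t' : ComposableArrows (Under c) Δ.unop.len := t
  refine (congrArg (gzToUnderNerve F Δ) (underNerveToGZ_mk F Δ c t' y)).trans
    ((gzToUnderNerve_mk F Δ _ _).trans ?_)
  refine (underNerveMk_map F Δ t'.left.hom _ y).symm.trans ?_
  refine congrArg (fun z => underNerveMk F Δ c z y) ?_
  refine ((underString_comp (t' ⋙ Under.forget c) t'.left.hom (𝟙 _)).symm.trans ?_).trans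
    (underString_forget t')
  exact congrArg (underString (t' ⋙ Under.forget c)) (Category.comp_id _)

/-- The simplicial modules `k[N_*(- ↓ C)] ⊗_C F` and `C_*(C, F)` are isomorphic. -/
def underNerveTensorIso : underNerveTensor F ≅ gabrielZisman F :=
  NatIso.ofComponents (fun Δ => LinearEquiv.toModuleIso
    (LinearEquiv.ofLinearMap (underNerveToGZ F Δ) (gzToUnderNerve F Δ)
      (underNerveToGZ_gzToUnderNerve F Δ) (gzToUnderNerve_underNerveToGZ F Δ))) (by
    intro Δ Δ' θ
    refine ModuleCat.hom_ext (underNerveTensor_hom_ext fun c t y => ?_)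
    let t' : ComposableArrows (Under c) Δ.unop.len := t
    refine (congrArg (underNerveToGZ F Δ') (underNerveTensor_map_mk F θ c t y)).trans
      ((underNerveToGZ_mk F Δ' c _ y).trans (Eq.symm ?_))
    refine (congrArg (GZ.map F θ) (underNerveToGZ_mk F Δ c t' y)).trans
      ((GZ.map_mk F θ _ _).trans ?_)
    refine congrArg (GZ.mk F Δ' _) ?_
    let a := θ.unop.toOrderHom 0
    have h : t'.left.hom ≫ (t'.map (homOfLE (Fin.zero_le a))).right = (t'.obj a).hom := Under.w _
    exact congrArg (fun l => l.hom y) ((F.map_comp _ _).symm.trans (congrArg F.map h)))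

end Comparison

/-! ### Epimorphisms and faces in $\Delta H$. -/

section Faces

/-- With trivial labels and permutation the sorting key compares $\varphi(p)$ first and $p$ second.
For an order-preserving $\varphi$ this is the usual order. -/
lemma pull_one {m n : ℕ} (φ : Fin m →o Fin n) : pull φ 1 = 1 := by
  refine HypGroup.ext rfl (perm_ext_of_lt fun p q => ?_)
  rw [pull_perm_lt_iff]
  simp only [HypGroup.one_perm, Equiv.Perm.one_apply, HypGroup.one_label, signedLT_one]
  refine ⟨?_, fun h => (φ.monotone h.le).lt_or_eq.imp id fun h' => ⟨h', h⟩⟩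
  rintro (h | h)
  · exact lt_of_not_ge fun h' => absurd (φ.monotone h') (not_le.2 h)
  · exact h.2

lemma push_one {m n : ℕ} (φ : Fin m →o Fin n) : push 1 φ = φ := by
  ext p
  have h := push_pull φ 1 p
  rw [pull_one] at h
  exact congrArg Fin.val h

namespace DeltaH

/-- A face is an injective order-preserving map, with the trivial element of the hyperoctahedral
group. -/
structure IsFace {X Y : DeltaH} (m : X ⟶ Y) : Prop where
  grp : m.grp = 1
  strictMono : StrictMono m.map

variable {X Y Z : DeltaH}

lemma comp_map_of_grp_eq_one (e : X ⟶ Y) {m : Y ⟶ Z} (hm : m.grp = 1) :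
    (e ≫ m).map = m.map.comp e.map := by
  change m.map.comp (push m.grp e.map) = _
  rw [hm, push_one]

lemma comp_grp_of_grp_eq_one (e : X ⟶ Y) {m : Y ⟶ Z} (hm : m.grp = 1) :
    (e ≫ m).grp = e.grp := by
  change pull e.map m.grp * e.grp = _
  rw [hm, pull_one, one_mul]

lemma hom_ext {f g : X ⟶ Y} (h : f.map = g.map) (h' : f.grp = g.grp) : f = g := by
  obtain ⟨φ, a⟩ : Hom X Y := f
  obtain ⟨ψ, b⟩ : Hom X Y := g
  obtain rfl : φ = ψ := h
  obtain rfl : a = b := h'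
  rfl

/-- The order-preserving map that sends `i` to the last point whose value under `δ` is at most
`i`. -/
def orderRetraction {m n : ℕ} (δ : Fin (m + 1) →o Fin n) : Fin n →o Fin (m + 1) where
  -- Below the smallest value of `δ` the supremum is over the empty set and equals 0; the source
  -- `Fin (m + 1)` has such a bottom element.
  toFun i := (Finset.univ.filter fun j => δ j ≤ i).sup id
  monotone' i i' h := Finset.sup_mono fun j hj => by
    simp only [Finset.mem_filter, Finset.mem_univ, true_and] at hj ⊢
    exact hj.trans h

lemma orderRetraction_comp {m n : ℕ} (δ : Fin (m + 1) →o Fin n) (hδ : StrictMono δ) :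
    (orderRetraction δ).comp δ = OrderHom.id := by
  refine OrderHom.ext _ _ (funext fun j => le_antisymm ?_ ?_)
  · change (Finset.univ.filter fun i => δ i ≤ δ j).sup id ≤ j
    exact Finset.sup_le fun i hi => hδ.le_iff_le.1 (Finset.mem_filter.1 hi).2
  · change j ≤ (Finset.univ.filter fun i => δ i ≤ δ j).sup id
    exact Finset.le_sup (f := id) (Finset.mem_filter.2 ⟨Finset.mem_univ j, le_rfl⟩)

/-- The morphism `Y ⟶ X` given by the retraction of the order-preserving map of `m`. -/
def retraction (m : X ⟶ Y) : Y ⟶ X := ⟨orderRetraction m.map, 1⟩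

/-- Both group elements are trivial, so the composite is computed on the order-preserving maps
alone. Faces are thus split monomorphisms. -/
lemma IsFace.comp_retraction {m : X ⟶ Y} (hm : IsFace m) : m ≫ retraction m = 𝟙 X := by
  refine hom_ext ?_ ?_
  · rw [comp_map_of_grp_eq_one _ rfl]
    exact orderRetraction_comp m.map hm.strictMono
  · rw [comp_grp_of_grp_eq_one _ rfl, hm.grp]
    rfl

lemma IsFace.mono {m : X ⟶ Y} (hm : IsFace m) : Mono m :=
  ⟨fun f g h => by
    have := congrArg (· ≫ retraction m) h
    simpa only [Category.assoc, hm.comp_retraction, Category.comp_id] using this⟩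

lemma isFace_id (X : DeltaH) : IsFace (𝟙 X) := ⟨rfl, strictMono_id⟩

/-- A morphism is determined by its values, its labels and the order it puts on pairs of points.
When `e` is surjective, all three can be read off $e$ followed by `f`; the order is read off because
two distinct points have disjoint fibres under `e`, and the composite compares points of distinct
fibres as `f` does. -/
lemma epi_of_surjective (e : X ⟶ Y) (he : Function.Surjective e.map) : Epi e where
  left_cancellation {Z} f g h := by
    have hs : ∀ i, ∃ p, e.map (e.grp.perm p) = i := fun i => by
      obtain ⟨q, rfl⟩ := he i
      exact ⟨e.grp.perm⁻¹ q, by simp⟩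
    have hmap : ∀ f : Y ⟶ Z, ∀ p, (e ≫ f).map ((e ≫ f).grp.perm p) =
        f.map (f.grp.perm (e.map (e.grp.perm p))) := fun f p =>
      congrArg f.map (push_pull e.map f.grp (e.grp.perm p))
    have hlt : ∀ f : Y ⟶ Z, ∀ p q, e.map (e.grp.perm p) ≠ e.map (e.grp.perm q) →
        ((e ≫ f).grp.perm p < (e ≫ f).grp.perm q ↔
          f.grp.perm (e.map (e.grp.perm p)) < f.grp.perm (e.map (e.grp.perm q))) :=
      fun f p q hpq => (pull_perm_lt_iff e.map f.grp _ _).trans (by simp [hpq])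
    refine Hom.ext_of (fun i => ?_) (fun i => ?_) (fun i j => ?_)
    · obtain ⟨p, rfl⟩ := hs i
      rw [← hmap, ← hmap, h]
    · obtain ⟨p, rfl⟩ := hs i
      have h' : (e ≫ f).grp.label p = (e ≫ g).grp.label p := by rw [h]
      exact mul_right_cancel h'
    · obtain ⟨p, rfl⟩ := hs i
      obtain ⟨q, rfl⟩ := hs j
      by_cases hpq : e.map (e.grp.perm p) = e.map (e.grp.perm q)
      · rw [hpq]
        simp
      · rw [← hlt f p q hpq, ← hlt g p q hpq, h]

/-- The factorisation of a morphism of `ΔH` through its image. -/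
lemma exists_epi_face (f : X ⟶ Y) :
    ∃ (S : EpiDeltaH) (e : X ⟶ S.obj) (m : S.obj ⟶ Y), Epi e ∧ IsFace m ∧ e ≫ m = f := by
  classical
  let s : Finset (Fin (Y.len + 1)) := Finset.univ.image f.map
  -- The image is nonempty, so it is a copy of the object $[|s|-1]$ and the subtraction loses
  -- nothing.
  have hs : s.card = s.card - 1 + 1 :=
    (Nat.sub_add_cancel (Finset.card_pos.2 (Finset.univ_nonempty.image _))).symm
  have hf : ∀ p, f.map p ∈ s := fun p => Finset.mem_image_of_mem _ (Finset.mem_univ p)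
  let δ := s.orderIsoOfFin hs
  -- The whole group element goes into the epimorphism, so that the second factor is a face.
  let e : X ⟶ ⟨s.card - 1⟩ :=
    ⟨⟨fun p => δ.symm ⟨f.map p, hf p⟩, fun p q h => δ.symm.monotone (f.map.monotone h)⟩, f.grp⟩
  let m : (⟨s.card - 1⟩ : DeltaH) ⟶ Y := ⟨⟨fun i => δ i, fun i j h => δ.monotone h⟩, 1⟩
  refine ⟨⟨⟨s.card - 1⟩⟩, e, m, epi_of_surjective e fun i => ?_, ⟨rfl, fun i j h => ?_⟩,
    hom_ext ?_ (comp_grp_of_grp_eq_one e rfl)⟩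
  · obtain ⟨p, -, hp⟩ := Finset.mem_image.1 (δ i).2
    refine ⟨p, δ.injective (Subtype.ext ?_)⟩
    change (δ (δ.symm ⟨f.map p, hf p⟩) : Fin (Y.len + 1)) = _
    rw [OrderIso.apply_symm_apply]
    exact hp
  · exact δ.strictMono h
  · rw [comp_map_of_grp_eq_one e rfl]
    refine OrderHom.ext _ _ (funext fun p => ?_)
    change (δ (δ.symm ⟨f.map p, hf p⟩) : Fin (Y.len + 1)) = _
    rw [OrderIso.apply_symm_apply]

end DeltaH

open DeltaH

/-! ### The category of faces and the image functor. -/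

/-- The objects of the category of faces: a face `[x] → [n]` of an object `[n]`. -/
structure FaceArrow : Type where
  left : EpiDeltaH
  right : DeltaH
  hom : left.obj ⟶ right
  isFace : IsFace hom

namespace FaceArrow

/-- The cardinality of the range fixes the source object, and a strictly increasing map out of it is
determined by its range. The conclusion is an equality of objects, not just an isomorphism, which
allows strings of faces to be compared strictly. -/
lemma mk_eq_of_range {S S' : EpiDeltaH} {Y : DeltaH} {m : S.obj ⟶ Y} {m' : S'.obj ⟶ Y}
    (hm : IsFace m) (hm' : IsFace m') (h : Set.range m.map = Set.range m'.map) :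
    FaceArrow.mk S Y m hm = FaceArrow.mk S' Y m' hm' := by
  have hc : S.obj.len + 1 = S'.obj.len + 1 := by
    have h1 := Nat.card_range_of_injective hm.strictMono.injective
    have h2 := Nat.card_range_of_injective hm'.strictMono.injective
    rw [h, h2] at h1
    simpa using h1.symm
  obtain ⟨⟨x⟩⟩ := S
  obtain ⟨⟨x'⟩⟩ := S'
  obtain rfl : x = x' := Nat.succ_injective hc
  obtain rfl : m = m' := hom_ext
    (OrderHom.ext _ _ ((hm.strictMono.range_inj hm'.strictMono).1 h)) (hm.grp.trans hm'.grp.symm)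
  rfl

/-- Uniqueness of images: epimorphisms are surjective, so both faces have the range of the
composite. -/
lemma mk_eq_of_comp {X Y : DeltaH} {S S' : EpiDeltaH} {e : X ⟶ S.obj} {e' : X ⟶ S'.obj}
    (he : Epi e) (he' : Epi e') {m : S.obj ⟶ Y} {m' : S'.obj ⟶ Y}
    (hm : IsFace m) (hm' : IsFace m') (h : e ≫ m = e' ≫ m') :
    FaceArrow.mk S Y m hm = FaceArrow.mk S' Y m' hm' := by
  refine mk_eq_of_range hm hm' ?_
  have h' := congrArg (fun f : X ⟶ Y => Set.range f.map) h
  simp only [comp_map_of_grp_eq_one _ hm.grp, comp_map_of_grp_eq_one _ hm'.grp] at h'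
  have h1 := (surjective_of_epi e).range_comp m.map
  have h2 := (surjective_of_epi e').range_comp m'.map
  exact h1.symm.trans (h'.trans h2)

/-- A morphism of faces is a commutative square whose left side is an epimorphism. -/
structure Hom (X Y : FaceArrow) : Type where
  left : X.left ⟶ Y.left
  right : X.right ⟶ Y.right
  w : left.hom ≫ Y.hom = X.hom ≫ right

/-- The left side is determined by the right side because a face is a monomorphism. Hence `target`
is faithful, and identities in `FaceArrow` can be checked on targets. -/
lemma Hom.ext_right {X Y : FaceArrow} {f g : Hom X Y} (h : f.right = g.right) : f = g := by
  obtain ⟨l, r, w⟩ := f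
  obtain ⟨l', r', w'⟩ := g
  obtain rfl : r = r' := h
  have := Y.isFace.mono
  obtain rfl : l = l' := WideSubcategory.hom_ext _ ((cancel_mono Y.hom).1 (w.trans w'.symm))
  rfl

instance : Category FaceArrow where
  Hom := Hom
  id X := ⟨𝟙 X.left, 𝟙 X.right, (Category.id_comp _).trans (Category.comp_id _).symm⟩
  comp {X Y Z} f g := ⟨f.left ≫ g.left, f.right ≫ g.right, by
    refine (Category.assoc f.left.hom g.left.hom Z.hom).trans ?_
    rw [g.w, ← Category.assoc, f.w, Category.assoc]⟩
  id_comp f := Hom.ext_right (Category.id_comp f.right)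
  comp_id f := Hom.ext_right (Category.comp_id f.right)
  assoc f g h := Hom.ext_right (Category.assoc f.right g.right h.right)

/-- The source of a face. -/
def source : FaceArrow ⥤ EpiDeltaH where
  obj X := X.left
  map f := f.left

/-- The target of a face. -/
def target : FaceArrow ⥤ DeltaH where
  obj X := X.right
  map f := f.right

instance : target.Faithful := ⟨fun h => Hom.ext_right h⟩

/-- The identities, as faces. -/
def identity : EpiDeltaH ⥤ FaceArrow where
  obj X := ⟨X, X.obj, 𝟙 X.obj, isFace_id X.obj⟩
  map f := ⟨f, f.hom, (Category.comp_id f.hom).trans (Category.id_comp f.hom).symm⟩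

/-- The square from the identity of `[x]` to a face `[x] → [n]`. -/
def identityToSelf : source ⋙ identity ⟶ 𝟭 FaceArrow where
  app X := ⟨𝟙 X.left, X.hom, rfl⟩
  naturality _ _ f := Hom.ext_right f.w

/-- The image of a morphism of `ΔH`. -/
def image {X Y : DeltaH} (f : X ⟶ Y) : FaceArrow :=
  ⟨(exists_epi_face f).choose, Y, (exists_epi_face f).choose_spec.choose_spec.choose,
    (exists_epi_face f).choose_spec.choose_spec.choose_spec.2.1⟩

/-- The morphism onto the image. -/
def toImage {X Y : DeltaH} (f : X ⟶ Y) : X ⟶ (image f).left.obj :=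
  (exists_epi_face f).choose_spec.choose

instance {X Y : DeltaH} (f : X ⟶ Y) : Epi (toImage f) :=
  (exists_epi_face f).choose_spec.choose_spec.choose_spec.1

lemma toImage_comp {X Y : DeltaH} (f : X ⟶ Y) : toImage f ≫ (image f).hom = f :=
  (exists_epi_face f).choose_spec.choose_spec.choose_spec.2.2

/-- Factor `X.hom ≫ r` as an epimorphism `e` and a face. Preceded by `p` this is an epi-face
factorisation of the same morphism as `q ≫ Y.hom`, so the face is `Y.hom` by uniqueness, and `e`
serves as the left side of the square. -/
lemma exists_hom {Z : DeltaH} {X Y : FaceArrow} (p : Z ⟶ X.left.obj) (q : Z ⟶ Y.left.obj) [Epi p]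
    [Epi q] (r : X.right ⟶ Y.right) (h : q ≫ Y.hom = p ≫ X.hom ≫ r) :
    ∃ f : X ⟶ Y, target.map f = r := by
  obtain ⟨S, e, m, he, hm, hem⟩ := exists_epi_face (X.hom ≫ r)
  obtain ⟨S', Y, m', hm'⟩ := Y
  have h' : (p ≫ e) ≫ m = q ≫ m' := by
    rw [Category.assoc, hem]
    exact h.symm
  cases mk_eq_of_comp (epi_comp p e) ‹Epi q› hm hm' h'
  exact ⟨⟨⟨e, he⟩, r, hem⟩, rfl⟩

lemma exists_image_map {X : DeltaH} {U V : Under X} (g : U ⟶ V) :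
    ∃ f : image U.hom ⟶ image V.hom, target.map f = g.right :=
  exists_hom (toImage U.hom) (toImage V.hom) g.right <|
    (toImage_comp V.hom).trans <| (Under.w g).symm.trans <|
      (congrArg (· ≫ g.right) (toImage_comp U.hom)).symm.trans (Category.assoc _ _ _)

/-- The image of a morphism of `ΔH`, as a functor on the under-category. -/
def imageFunctor (X : DeltaH) : Under X ⥤ FaceArrow where
  obj U := image U.hom
  map g := (exists_image_map g).choose
  map_id U := target.map_injective ((exists_image_map (𝟙 U)).choose_spec)
  map_comp g h := target.map_injective <| by
    rw [(exists_image_map (g ≫ h)).choose_spec, target.map_comp, (exists_image_map g).choose_spec,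
      (exists_image_map h).choose_spec]
    rfl

lemma imageFunctor_target (X : DeltaH) : imageFunctor X ⋙ target = Under.forget X :=
  CategoryTheory.Functor.ext (fun _ => rfl) fun _ _ g =>
    (exists_image_map g).choose_spec.trans ((Category.id_comp _).trans (Category.comp_id _)).symm

/-- A string of faces can be recovered from its targets and from its first face. -/
lemma underString_imageFunctor {n : ℕ} (s : ComposableArrows FaceArrow n) :
    underString (s ⋙ target) s.left.hom ⋙ imageFunctor s.left.left.obj = s := by
  have h : ∀ i, (underString (s ⋙ target) s.left.hom ⋙ imageFunctor s.left.left.obj).obj i =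
      s.obj i := fun i => by
    let f : s.left ⟶ s.obj i := s.map (homOfLE (Fin.zero_le i))
    -- The square from the first face to the $i$-th one has an epimorphism on its left, so the
    -- $i$-th face is the image of the first face followed by the targets.
    exact mk_eq_of_comp (e := toImage (s.left.hom ≫ f.right)) (e' := f.left.hom)
      inferInstance f.left.property (image (s.left.hom ≫ f.right)).isFace (s.obj i).isFace
      ((toImage_comp _).trans f.w.symm)
  refine CategoryTheory.Functor.ext h fun i j g => target.map_injective ?_
  rw [target.map_comp, target.map_comp, eqToHom_map, eqToHom_map]
  refine (exists_image_map _).choose_spec.trans ?_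
  exact ((Category.id_comp _).trans (Category.comp_id _)).symm

lemma string_ext {n : ℕ} {s s' : ComposableArrows FaceArrow n} (h : s ⋙ target = s' ⋙ target)
    (h' : s.left = s'.left) : s = s' := by
  -- The face `Z` and the string `t` are made independent, linked only through `eqToHom`, so that
  -- both equalities can be substituted.
  have key : ∀ (t t' : ComposableArrows DeltaH n) (Z Z' : FaceArrow) (e : Z.right = t.left)
      (e' : Z'.right = t'.left), t = t' → Z = Z' →
      underString t (Z.hom ≫ eqToHom e) ⋙ imageFunctor Z.left.obj ≍
        underString t' (Z'.hom ≫ eqToHom e') ⋙ imageFunctor Z'.left.obj := by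
    rintro t _ Z _ e e' rfl rfl
    rfl
  have hk := eq_of_heq (key (s ⋙ target) (s' ⋙ target) s.left s'.left rfl rfl h h')
  have hc : ∀ X : FaceArrow, X.hom ≫ eqToHom rfl = X.hom := fun X => Category.comp_id _
  rw [← underString_imageFunctor s, ← underString_imageFunctor s']
  exact (congrArg (fun f => underString (s ⋙ target) f ⋙ imageFunctor s.left.left.obj)
    (hc s.left)).symm.trans (hk.trans (congrArg (fun f => underString (s' ⋙ target) f ⋙
      imageFunctor s'.left.left.obj) (hc s'.left)))

end FaceArrow

end Faces

open DeltaH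

/-! ### The splitting $A=k\oplus I$ and the summands of $A^{\otimes n+1}$. -/

section FaceMaps

variable {k : Type u} {A : Type v} [CommRing k] [Ring A] [Algebra k A]
  (α : AugmentedInvolution k A)

/-- The projection of `A = k ⊕ I` onto `I`. -/
def AugmentedInvolution.toIdeal : A →ₗ[k] α.ideal :=
  (LinearMap.id - (Algebra.linearMap k A) ∘ₗ α.aug.toLinearMap).codRestrict α.ideal fun a => by
    simp [AugmentedInvolution.ideal]

lemma AugmentedInvolution.toIdeal_coe (a : α.ideal) : α.toIdeal a = a := by
  have h : α.aug a = 0 := a.2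
  refine Subtype.ext ?_
  change (a : A) - algebraMap k A (α.aug a) = a
  rw [h, map_zero, sub_zero]

lemma AugmentedInvolution.toIdeal_one : α.toIdeal 1 = 0 := by
  refine Subtype.ext ?_
  change (1 : A) - algebraMap k A (α.aug 1) = 0
  rw [map_one, map_one, sub_self]

lemma barFactor_one_apply (ι : Involution k A) {m n : ℕ} (δ : Fin m →o Fin n) (hδ : StrictMono δ)
    (a : Fin m → A) (i : Fin m) : barFactor ι δ 1 a (δ i) = a i := by
  have : fibre δ (δ i) = [i] := by
    refine List.Perm.eq_singleton ?_
    exact (List.perm_ext_iff_of_nodup (fibre_nodup _ _) (List.nodup_singleton _)).2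
      (by simp [hδ.injective.eq_iff])
  simp [barFactor, this]

lemma barFactor_of_notMem_range (ι : Involution k A) {m n : ℕ} (φ : Fin m →o Fin n)
    (g : HypGroup m) (a : Fin m → A) {j : Fin n} (hj : j ∉ Set.range φ) :
    barFactor ι φ g a j = 1 := by
  have : fibre φ j = [] := List.eq_nil_iff_forall_not_mem.2 fun p hp => hj ⟨p, mem_fibre.1 hp⟩
  simp [barFactor, this]

/-- The map `I^{⊗ (x + 1)} → A^{⊗ (n + 1)}` induced by a morphism `[x] → [n]`. -/
def faceMap {S : EpiDeltaH} {Y : DeltaH} (m : S.obj ⟶ Y) :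
    (idealConstruction α).obj S ⟶ (barConstruction α.toInvolution).obj Y :=
  (idealToBar α).app S ≫ (barConstruction α.toInvolution).map m

lemma faceMap_tprod {S : EpiDeltaH} {Y : DeltaH} (m : S.obj ⟶ Y)
    (a : Fin (S.obj.len + 1) → α.ideal) :
    (faceMap α m).hom (PiTensorProduct.tprod k a) =
      PiTensorProduct.tprod k (barFactor α.toInvolution m.map m.grp fun i => (a i : A)) :=
  (congrArg (barMap α.toInvolution m.map m.grp) (PiTensorProduct.map_tprod _ _)).trans
    (barMap_tprod _ _ _ _)

open Classical in
/-- The projection of `A^{⊗ n}` onto the summand `I^{⊗ R}`, with respect to the decomposition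
`A = k ⊕ I`. -/
def summandProjection {n : ℕ} (R : Set (Fin n)) : (⨂[k] _ : Fin n, A) →ₗ[k] ⨂[k] _ : Fin n, A :=
  PiTensorProduct.map fun i => if i ∈ R then α.ideal.subtype ∘ₗ α.toIdeal else
    Algebra.linearMap k A ∘ₗ α.aug.toLinearMap

/-- Some point lies in exactly one of the two ranges. If it is missed by `m`, the tensor factor
there is 1, which the projection to $I$ kills; if it is missed by `m'`, the factor lies in $I$ and
the augmentation kills it. -/
lemma summandProjection_faceMap {S S' : EpiDeltaH} {Y : DeltaH} {m : S.obj ⟶ Y} {m' : S'.obj ⟶ Y}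
    (hm : IsFace m) (y : (idealConstruction α).obj S)
    (h : Set.range m.map ≠ Set.range m'.map) :
    summandProjection α (Set.range m'.map) ((faceMap α m).hom y) = 0 := by
  let L : (⨂[k] _ : Fin (S.obj.len + 1), α.ideal) →ₗ[k] ⨂[k] _ : Fin (Y.len + 1), A :=
    summandProjection α (Set.range m'.map) ∘ₗ (faceMap α m).hom
  have hL : L = 0 := PiTensorProduct.ext (MultilinearMap.ext fun a => by
    refine (congrArg (summandProjection α (Set.range m'.map)) (faceMap_tprod α m a)).trans ?_
    refine (PiTensorProduct.map_tprod _ _).trans ?_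
    obtain ⟨j, hj⟩ : ∃ j, ¬ (j ∈ Set.range m.map ↔ j ∈ Set.range m'.map) := by
      by_contra! h'
      exact h (Set.ext h')
    refine MultilinearMap.map_coord_zero _ j ?_
    by_cases hj' : j ∈ Set.range m'.map
    · rw [if_pos hj', barFactor_of_notMem_range _ _ _ _ (by tauto)]
      simp [AugmentedInvolution.toIdeal_one]
    · obtain ⟨i, rfl⟩ : j ∈ Set.range m.map := by tauto
      rw [if_neg hj', hm.grp, barFactor_one_apply _ _ hm.strictMono]
      have : α.aug (a i) = 0 := (a i).2
      simp [this])
  exact congrArg (fun l => l y) hL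

lemma summandProjection_faceMap_self {S : EpiDeltaH} {Y : DeltaH} {m : S.obj ⟶ Y}
    (hm : IsFace m) (y : (idealConstruction α).obj S) :
    summandProjection α (Set.range m.map) ((faceMap α m).hom y) = (faceMap α m).hom y := by
  let L : (⨂[k] _ : Fin (S.obj.len + 1), α.ideal) →ₗ[k] ⨂[k] _ : Fin (Y.len + 1), A :=
    summandProjection α (Set.range m.map) ∘ₗ (faceMap α m).hom
  have hL : L = (faceMap α m).hom := PiTensorProduct.ext (MultilinearMap.ext fun a => by
    refine (congrArg (summandProjection α (Set.range m.map)) (faceMap_tprod α m a)).trans ?_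
    refine (PiTensorProduct.map_tprod _ _).trans (Eq.trans ?_ (faceMap_tprod α m a).symm)
    refine congrArg (PiTensorProduct.tprod k) (funext fun j => ?_)
    by_cases hj : j ∈ Set.range m.map
    · rw [if_pos hj]
      obtain ⟨i, rfl⟩ := hj
      rw [hm.grp, barFactor_one_apply _ _ hm.strictMono]
      simp [AugmentedInvolution.toIdeal_coe]
    · rw [if_neg hj, barFactor_of_notMem_range _ _ _ _ hj]
      simp)
  exact congrArg (fun l => l y) hL

/-- The projection of `A^{⊗ (n + 1)}` onto the image of the map induced by a face `m`, as a map to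
the source of the latter. -/
def faceProjection {S : EpiDeltaH} {Y : DeltaH} (m : S.obj ⟶ Y) :
    (barConstruction α.toInvolution).obj Y →ₗ[k] (idealConstruction α).obj S :=
  PiTensorProduct.map (fun _ => α.toIdeal) ∘ₗ
    ((barConstruction α.toInvolution).map (retraction m)).hom ∘ₗ
      summandProjection α (Set.range m.map)

/-- The summand projection fixes the image of the face, the retraction undoes `m`, and `toIdeal`
recovers each factor. The explicit left inverse gives injectivity of $I^{\otimes x+1}\to A^{\otimes
n+1}$ over any `k`, without flatness. -/
lemma faceProjection_faceMap_self {S : EpiDeltaH} {Y : DeltaH} {m : S.obj ⟶ Y}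
    (hm : IsFace m) (y : (idealConstruction α).obj S) :
    faceProjection α m ((faceMap α m).hom y) = y := by
  let H := barConstruction α.toInvolution
  have h : H.map m ≫ H.map (retraction m) = 𝟙 _ := by
    rw [← H.map_comp, hm.comp_retraction, H.map_id]
  refine (congrArg (fun z => PiTensorProduct.map (fun _ => α.toIdeal)
    ((H.map (retraction m)).hom z)) (summandProjection_faceMap_self α hm y)).trans ?_
  refine (congrArg (fun l => PiTensorProduct.map (fun _ => α.toIdeal)
    (l.hom (((idealToBar α).app S).hom y))) h).trans ?_
  let L : (⨂[k] _ : Fin (S.obj.len + 1), α.ideal) →ₗ[k] ⨂[k] _ : Fin (S.obj.len + 1), α.ideal :=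
    PiTensorProduct.map (fun _ => α.toIdeal) ∘ₗ ((idealToBar α).app S).hom
  have hL : L = LinearMap.id := PiTensorProduct.ext (MultilinearMap.ext fun a => by
    refine (congrArg (PiTensorProduct.map fun _ => α.toIdeal)
      (PiTensorProduct.map_tprod _ _)).trans ?_
    refine (PiTensorProduct.map_tprod _ _).trans (congrArg (PiTensorProduct.tprod k) ?_)
    exact funext fun j => α.toIdeal_coe (a j))
  exact congrArg (fun l => l y) hL

lemma faceProjection_faceMap {S S' : EpiDeltaH} {Y : DeltaH} {m : S.obj ⟶ Y} {m' : S'.obj ⟶ Y}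
    (hm : IsFace m) (hm' : IsFace m') (y : (idealConstruction α).obj S)
    (h : FaceArrow.mk S Y m hm ≠ FaceArrow.mk S' Y m' hm') :
    faceProjection α m' ((faceMap α m).hom y) = 0 := by
  refine (congrArg (fun z => PiTensorProduct.map (fun _ => α.toIdeal)
    (((barConstruction α.toInvolution).map (retraction m')).hom z))
    (summandProjection_faceMap α hm y
      fun h' => h (FaceArrow.mk_eq_of_range hm hm' h'))).trans ?_
  exact (congrArg _ (map_zero _)).trans (map_zero _)

end FaceMaps

/-! ### The reduced complex as the complex of strings of faces. -/

section Decomposition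

variable {k : Type u} {A : Type v} [CommRing k] [Ring A] [Algebra k A]
  (α : AugmentedInvolution k A)

/-- The functor that sends a face `[x] → [n]` to `I^{⊗ (x + 1)}`. -/
abbrev faceConstruction : FaceArrow ⥤ ModuleCat.{max u v} k :=
  FaceArrow.source ⋙ idealConstruction α

/-- The maps `I^{⊗ (x + 1)} → A^{⊗ (n + 1)}` induced by the faces `[x] → [n]`. -/
def faceToBar : faceConstruction α ⟶ FaceArrow.target ⋙ barConstruction α.toInvolution where
  app X := faceMap α X.hom
  naturality X Y f := by
    let H := barConstruction α.toInvolution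
    have h1 : (idealConstruction α).map f.left ≫ (idealToBar α).app Y.left =
        (idealToBar α).app X.left ≫ H.map f.left.hom := (idealToBar α).naturality f.left
    have h2 : H.map f.left.hom ≫ H.map Y.hom = H.map X.hom ≫ H.map f.right := by
      rw [← H.map_comp, f.w, H.map_comp]
    change (idealConstruction α).map f.left ≫ (idealToBar α).app Y.left ≫ H.map Y.hom =
      ((idealToBar α).app X.left ≫ H.map X.hom) ≫ H.map f.right
    exact (Category.assoc _ _ _).symm.trans ((congrArg (· ≫ H.map Y.hom) h1).trans
      ((Category.assoc _ _ _).trans ((congrArg ((idealToBar α).app X.left ≫ ·) h2).trans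
        (Category.assoc _ _ _).symm)))

/-- Distinct pairs of a target string and a first face are separated: by the direct sum over strings
if the strings differ, and by the face projection otherwise. -/
lemma component_mk_faceMap (Δ : SimplexCategoryᵒᵖ) (t t' : ComposableArrows DeltaH Δ.unop.len)
    {S S' : EpiDeltaH} {m : S.obj ⟶ t.left} {m' : S'.obj ⟶ t'.left} (hm : IsFace m)
    (hm' : IsFace m') (y : (idealConstruction α).obj S)
    (h : t = t' → FaceArrow.mk S t.left m hm ≠ FaceArrow.mk S' t'.left m' hm') :
    faceProjection α m' (GZ.component (barConstruction α.toInvolution) Δ t'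
      (GZ.mk (barConstruction α.toInvolution) Δ t ((faceMap α m).hom y))) = 0 := by
  by_cases ht : t = t'
  · subst ht
    exact (congrArg (faceProjection α m') (GZ.component_mk_self _ Δ t _)).trans
      (faceProjection_faceMap α hm hm' y (h rfl))
  · exact (congrArg (faceProjection α m') (GZ.component_mk_of_ne _ Δ ht _)).trans (map_zero _)

/-- The coefficient at a string of faces is recovered by taking the component at its target string
and projecting onto the summand of its first face. No other string of faces contributes, by
`FaceArrow.string_ext`. -/
lemma mapFunctor_faceToBar_injective (Δ : SimplexCategoryᵒᵖ) :
    Function.Injective (GZ.mapFunctor FaceArrow.target (faceToBar α) Δ) := by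
  let H := barConstruction α.toInvolution
  rw [← LinearMap.ker_eq_bot, LinearMap.ker_eq_bot']
  intro x hx
  refine DFinsupp.ext fun s => ?_
  let p : GZ H Δ →ₗ[k] (faceConstruction α).obj s.left :=
    faceProjection α s.left.hom ∘ₗ GZ.component H Δ (s ⋙ FaceArrow.target)
  have h : p ∘ₗ GZ.mapFunctor FaceArrow.target (faceToBar α) Δ =
      GZ.component (faceConstruction α) Δ s := by
    refine GZ.hom_ext fun s' y => ?_
    refine (congrArg p (GZ.mapFunctor_mk FaceArrow.target (faceToBar α) Δ s' y)).trans ?_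
    by_cases hs : s' = s
    · subst hs
      refine (congrArg (faceProjection α s'.left.hom)
        (GZ.component_mk_self H Δ (s' ⋙ FaceArrow.target) _)).trans ?_
      exact (faceProjection_faceMap_self α s'.left.isFace y).trans
        (GZ.component_mk_self (faceConstruction α) Δ s' y).symm
    · refine (component_mk_faceMap α Δ (s' ⋙ FaceArrow.target) (s ⋙ FaceArrow.target)
        s'.left.isFace s.left.isFace y fun ht hm => hs ?_).trans
          (GZ.component_mk_of_ne (faceConstruction α) Δ hs y).symm
      exact FaceArrow.string_ext ht hm
  exact (congrArg (fun l => l x) h).symm.trans ((congrArg p hx).trans (map_zero p))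

/-- The map `((f_n, …, f_1), y) ↦ [(f_n, …, f_1, f_0) ⊗ y]`, for a string `(f_n, …, f_1)` of faces
whose first face is `f_0`, and for `y` in `I^{⊗ (x + 1)}`. -/
def faceToUnderNerve :
    gabrielZisman (faceConstruction α) ⟶ underNerveTensor (barConstruction α.toInvolution) :=
  gabrielZismanMap FaceArrow.target (faceToBar α) ≫
    (underNerveTensorIso (barConstruction α.toInvolution)).inv

/-- The tensor relation moves the first face from the coefficient into the string, where it takes
the place of $f_0=\mathrm{id}$. The remaining coefficient is a tensor over $I$. -/
lemma faceToUnderNerve_mk (Δ : SimplexCategoryᵒᵖ) (s : ComposableArrows FaceArrow Δ.unop.len)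
    (y : (faceConstruction α).obj s.left) :
    ((faceToUnderNerve α).app Δ).hom (GZ.mk (faceConstruction α) Δ s y) =
      underNerveMk (barConstruction α.toInvolution) Δ s.left.left.obj
        (underString (s ⋙ FaceArrow.target) s.left.hom)
        (((idealToBar α).app s.left.left).hom y) := by
  let H := barConstruction α.toInvolution
  refine (congrArg (gzToUnderNerve H Δ)
    (GZ.mapFunctor_mk FaceArrow.target (faceToBar α) Δ s y)).trans ?_
  refine (gzToUnderNerve_mk H Δ _ _).trans ?_
  refine (underNerveMk_map H Δ s.left.hom _ _).symm.trans ?_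
  refine congrArg (fun z => underNerveMk H Δ s.left.left.obj z
    (((idealToBar α).app s.left.left).hom y)) ?_
  refine (underString_comp (s ⋙ FaceArrow.target) s.left.hom (𝟙 _)).symm.trans ?_
  exact congrArg (underString (s ⋙ FaceArrow.target)) (Category.comp_id _)

lemma faceToUnderNerve_injective (Δ : SimplexCategoryᵒᵖ) :
    Function.Injective ((faceToUnderNerve α).app Δ).hom := by
  have h : Function.Injective (gzToUnderNerve (barConstruction α.toInvolution) Δ) :=
    Function.LeftInverse.injective (g := underNerveToGZ (barConstruction α.toInvolution) Δ)
      fun x => congrArg (fun l => l x) (underNerveToGZ_gzToUnderNerve _ Δ)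
  exact h.comp (mapFunctor_faceToBar_injective α Δ)

lemma underNerveMk_idealToBar_mem (Δ : SimplexCategoryᵒᵖ) (S : EpiDeltaH)
    (t : ComposableArrows (Under S.obj) Δ.unop.len) (y : (idealConstruction α).obj S) :
    underNerveMk (barConstruction α.toInvolution) Δ S.obj t (((idealToBar α).app S).hom y) ∈
      reducedSubmodule α Δ := by
  let H := barConstruction α.toInvolution
  let L : (⨂[k] _ : Fin (S.obj.len + 1), α.ideal) →ₗ[k]
      (underNerveTensor H).obj Δ ⧸ reducedSubmodule α Δ :=
    (reducedSubmodule α Δ).mkQ ∘ₗ TensorOver.mk ((underNerveModule k DeltaH).obj Δ) H S.obj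
      (Finsupp.single t (1 : k)) ∘ₗ ((idealToBar α).app S).hom
  have hL : L = 0 := PiTensorProduct.ext (MultilinearMap.ext fun a => by
    refine (Submodule.Quotient.mk_eq_zero _).2 (Submodule.subset_span ⟨S.obj, t, fun i => a i,
      fun i => (a i).2, ?_⟩)
    exact congrArg (underNerveMk H Δ S.obj t) (PiTensorProduct.map_tprod _ _))
  exact (Submodule.Quotient.mk_eq_zero _).1 (congrArg (fun l => l y) hL)

/-- For the inclusion of the reduced submodule in the range, write $f_0=me$ with `e` onto the image
and `m` the first face of the string of images. Then $[(f_n,\dots,f_1,me)\otimes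
a]=[(f_n,\dots,f_1,m)\otimes e_*a]$, and $e_*a$ comes from $I$: each product is over a nonempty
fibre. -/
lemma faceToUnderNerve_range (Δ : SimplexCategoryᵒᵖ) :
    LinearMap.range ((faceToUnderNerve α).app Δ).hom = reducedSubmodule α Δ := by
  let H := barConstruction α.toInvolution
  refine le_antisymm ?_ (Submodule.span_le.2 ?_)
  · rintro _ ⟨x, rfl⟩
    have h : (reducedSubmodule α Δ).mkQ ∘ₗ ((faceToUnderNerve α).app Δ).hom = 0 :=
      GZ.hom_ext fun s y => (Submodule.Quotient.mk_eq_zero _).2 <| by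
        rw [faceToUnderNerve_mk]
        exact underNerveMk_idealToBar_mem α Δ _ _ _
    exact (Submodule.Quotient.mk_eq_zero _).1 (congrArg (fun l => l x) h)
  · rintro _ ⟨X, t, a, ha, rfl⟩
    let t' : ComposableArrows (Under X) Δ.unop.len := t
    let S : EpiDeltaH := ⟨X⟩
    let s : ComposableArrows FaceArrow Δ.unop.len := t' ⋙ FaceArrow.imageFunctor X
    let e : S ⟶ s.left.left :=
      ⟨FaceArrow.toImage t'.left.hom, inferInstanceAs (Epi (FaceArrow.toImage t'.left.hom))⟩
    let y : (idealConstruction α).obj S :=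
      PiTensorProduct.tprod k fun i => (⟨a i, ha i⟩ : α.ideal)
    refine ⟨GZ.mk (faceConstruction α) Δ s (((idealConstruction α).map e).hom y), ?_⟩
    refine (faceToUnderNerve_mk α Δ s _).trans ?_
    have h1 : ((idealToBar α).app s.left.left).hom (((idealConstruction α).map e).hom y) =
        (H.map e.hom).hom (((idealToBar α).app S).hom y) :=
      congrArg (fun l => l.hom y) ((idealToBar α).naturality e)
    have h2 : ((idealToBar α).app S).hom y = PiTensorProduct.tprod k a :=
      PiTensorProduct.map_tprod _ _
    rw [h1, h2]
    refine (underNerveMk_map H Δ e.hom _ _).symm.trans ?_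
    refine congrArg (fun z => underNerveMk H Δ X z (PiTensorProduct.tprod k a)) ?_
    refine (underString_comp _ _ _).symm.trans ?_
    refine underString_eq t' ?_ (heq_of_eq (FaceArrow.toImage_comp t'.left.hom))
    exact congrArg (fun G => t' ⋙ G) (FaceArrow.imageFunctor_target X)

/-- The isomorphism of the complex of strings of faces with the reduced complex. -/
def faceToReduced : gabrielZisman (faceConstruction α) ⟶ reducedSimplicial α where
  app Δ := ModuleCat.ofHom <| ((faceToUnderNerve α).app Δ).hom.codRestrict (reducedSubmodule α Δ)
    fun x => (faceToUnderNerve_range α Δ).le ⟨x, rfl⟩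
  naturality _ _ θ := ModuleCat.hom_ext (LinearMap.ext fun x => Subtype.ext
    (congrArg (fun l => l.hom x) ((faceToUnderNerve α).naturality θ)))

instance : IsIso (faceToReduced α) := by
  have h : ∀ Δ, IsIso ((faceToReduced α).app Δ) := fun Δ => by
    refine (ConcreteCategory.isIso_iff_bijective _).2 ⟨fun x y hxy => ?_, fun t => ?_⟩
    · exact faceToUnderNerve_injective α Δ (congrArg Subtype.val hxy)
    · obtain ⟨x, hx⟩ := (faceToUnderNerve_range α Δ).ge t.2
      exact ⟨x, Subtype.ext hx⟩
  exact NatIso.isIso_of_isIso_app _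

end Decomposition

/-! ### The deformation retraction of faces onto epimorphisms. -/

section Equivalence

variable {k : Type u} {A : Type v} [CommRing k] [Ring A] [Algebra k A]
  (α : AugmentedInvolution k A)

/-- Strings of epimorphisms, as strings of identity faces. -/
def epiToFace : gabrielZisman (idealConstruction α) ⟶ gabrielZisman (faceConstruction α) :=
  gabrielZismanMap FaceArrow.identity
    { app := fun X => 𝟙 ((idealConstruction α).obj X)
      naturality := fun _ _ _ => (Category.comp_id _).trans (Category.id_comp _).symm }

/-- The strings of sources of strings of faces. -/
def faceToEpi : gabrielZisman (faceConstruction α) ⟶ gabrielZisman (idealConstruction α) :=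
  gabrielZismanMap FaceArrow.source
    { app := fun X => 𝟙 ((idealConstruction α).obj X.left)
      naturality := fun _ _ _ => (Category.comp_id _).trans (Category.id_comp _).symm }

/-- The source of an identity face is the object itself, so this composite is strictly the identity
and needs no homotopy. -/
lemma epiToFace_faceToEpi : epiToFace α ≫ faceToEpi α = 𝟙 (gabrielZisman (idealConstruction α)) :=
  (gabrielZismanMap_comp _ _ _ _
    { app := fun X => 𝟙 ((idealConstruction α).obj X)
      naturality := fun _ _ _ => (Category.comp_id _).trans (Category.id_comp _).symm }
    fun _ => (Category.id_comp _).symm).trans (gabrielZismanMap_id _ fun _ => rfl)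

/-- The homotopy from the composite of `faceToEpi` and `epiToFace` to the identity. -/
def faceHomotopy :
    SimplicialObject.Homotopy (faceToEpi α ≫ epiToFace α)
      (𝟙 (gabrielZisman (faceConstruction α))) := by
  let η : faceConstruction α ⟶ (FaceArrow.source ⋙ FaceArrow.identity) ⋙ faceConstruction α :=
    { app := fun X => 𝟙 ((idealConstruction α).obj X.left)
      naturality := fun _ _ _ => (Category.comp_id _).trans (Category.id_comp _).symm }
  let η' : faceConstruction α ⟶ 𝟭 FaceArrow ⋙ faceConstruction α :=
    { app := fun X => 𝟙 ((idealConstruction α).obj X.left)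
      naturality := fun _ _ _ => (Category.comp_id _).trans (Category.id_comp _).symm }
  have h : faceToEpi α ≫ epiToFace α = gabrielZismanMap _ η :=
    gabrielZismanMap_comp _ _ _ _ η fun _ => (Category.id_comp _).symm
  have h' : gabrielZismanMap _ η' = 𝟙 (gabrielZisman (faceConstruction α)) :=
    gabrielZismanMap_id η' fun _ => rfl
  rw [h, ← h']
  -- The left side of each square of `identityToSelf` is an identity, and the coefficients only see
  -- the left side.
  exact gabrielZismanHomotopy FaceArrow.identityToSelf η η' fun X =>
    (Category.id_comp _).trans ((idealConstruction α).map_id X.left)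

/-- The homotopy equivalence between the complexes of strings of epimorphisms and of faces. -/
def epiFaceEquiv : HomotopyEquiv (toComplex (gabrielZisman (idealConstruction α)))
    (toComplex (gabrielZisman (faceConstruction α))) where
  hom := (AlgebraicTopology.alternatingFaceMapComplex _).map (epiToFace α)
  inv := (AlgebraicTopology.alternatingFaceMapComplex _).map (faceToEpi α)
  homotopyHomInvId := Homotopy.ofEq <| by
    rw [← Functor.map_comp, epiToFace_faceToEpi, CategoryTheory.Functor.map_id]
  homotopyInvHomId := (Homotopy.ofEq (Functor.map_comp _ _ _).symm).trans
    ((faceHomotopy α).toChainHomotopy.trans (Homotopy.ofEq (CategoryTheory.Functor.map_id _ _)))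

/-- It suffices to compare on classes with $f_0=\mathrm{id}$. A string of epimorphisms with
$f_0=\mathrm{id}$ is the string of its identity faces, and both maps send it to itself. Consequently
the forward map of the homotopy equivalence is the inclusion. -/
lemma epiToReducedSimplicial_eq : epiToReducedSimplicial α =
    (underNerveTensorIso (idealConstruction α)).hom ≫ epiToFace α ≫ faceToReduced α := by
  rw [← Iso.inv_comp_eq]
  refine gabrielZisman_hom_ext fun Δ s y => Subtype.ext ?_
  refine (congrArg ((underNerveTensorMap epiInclusion (idealToBar α)).app Δ).hom
    (gzToUnderNerve_mk (idealConstruction α) Δ s y)).trans ?_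
  refine (underNerveTensorMap_mk epiInclusion (idealToBar α) Δ _ _ y).trans (Eq.symm ?_)
  refine (congrArg ((faceToUnderNerve α).app Δ).hom
    (GZ.mapFunctor_mk FaceArrow.identity _ Δ s y)).trans ?_
  exact faceToUnderNerve_mk α Δ _ _

/-- The inclusion of complexes, as a homotopy equivalence. -/
def epiReducedEquiv : HomotopyEquiv (epiComplex α) (reducedComplex α) :=
  (HomotopyEquiv.ofIso ((AlgebraicTopology.alternatingFaceMapComplex _).mapIso
    (underNerveTensorIso (idealConstruction α)))).trans
  ((epiFaceEquiv α).trans (HomotopyEquiv.ofIso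
    ((AlgebraicTopology.alternatingFaceMapComplex _).mapIso (asIso (faceToReduced α)))))

lemma epiReducedEquiv_hom : (epiReducedEquiv α).hom = epiToReduced α := by
  rw [epiToReduced, epiToReducedSimplicial_eq, Functor.map_comp, Functor.map_comp]
  rfl

end Equivalence

end Hyperoctahedral

end

theorem mainTheorem4 {k : Type*} {A : Type*} [CommRing k] [Ring A] [Algebra k A]
    (α : Hyperoctahedral.AugmentedInvolution k A) :
    (∃ e : HomotopyEquiv (Hyperoctahedral.epiComplex α) (Hyperoctahedral.reducedComplex α),
      e.hom = Hyperoctahedral.epiToReduced α) ∧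
    ∀ n : ℕ,
      Nonempty (Hyperoctahedral.reducedHO α n ≅ (Hyperoctahedral.epiComplex α).homology n) ∧
      Nonempty ((Hyperoctahedral.epiComplex α).homology n ≅
        (Hyperoctahedral.epiGabrielZisman α).homology n) :=
  ⟨⟨Hyperoctahedral.epiReducedEquiv α, Hyperoctahedral.epiReducedEquiv_hom α⟩, fun n =>
    ⟨⟨((Hyperoctahedral.epiReducedEquiv α).toHomologyIso n).symm⟩,
      ⟨(HomotopyEquiv.ofIso ((AlgebraicTopology.alternatingFaceMapComplex _).mapIso
        (Hyperoctahedral.underNerveTensorIso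
          (Hyperoctahedral.idealConstruction α)))).toHomologyIso n⟩⟩⟩
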